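/- Fix $0<\alpha<\gamma<1$, standard deviations $\sigma_x>0$, $\sigma_\eta,\sigma_\varepsilon\ge 0$, constants $B,C_\psi,C_M,C\ge 0$, a depth $L\ge 0$, and dimensions $d=d_n$ with $\log n\ll d\ll n^{\alpha}$ as $n\to\infty$. Let $\beta=\beta_n\in\mathbb{R}^{d}$ be deterministic with $\|\beta\|\le B$ (Euclidean norm). Model. For $i=1,\dots,n+1$ let $x_i\sim N(0,\sigma_x^2I_d)$, $\eta_i\sim N(0,\sigma_\eta^2I_d)$, $\varepsilon_i\sim N(0,\sigma_\varepsilon^2)$ be mutually independent, and put $z_i=x_i+\eta_i$, $y_i=x_i^\top\beta+\varepsilon_i$. Distinct nodes $i,j\in\{1,\dots,n+1\}$ are joined by an edge if $x_i^\top x_j\ge\sigma_x^2t_n\sqrt d$, where $t_n=\sqrt{2(1-\alpha)\log n}$, or if the pair $\{i,j\}$ is an Erdős–Rényi edge; each pair is an Erdős–Rényi edge with probability $p_n=n^{\gamma-1}$, independently of the other pairs and of all $x_i,\eta_i,\varepsilon_i$. Let $N_i$ be the set of neighbours of $i$. Let $\mathcal{F}_n=\sigma(y_1,\dots,y_n,z_1,\dots,z_{n+1})$.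 Network. For $0\le\ell<L$ let $\psi_\ell:\mathbb{R}^d\to\mathbb{R}^d$ be random odd $C_\psi$-Lipschitz functions and $M_0^{(\ell)},M_1^{(\ell)}\in\mathbb{R}^{d\times d}$ random matrices with operator norm at most $C_M$, and let $g:\mathbb{R}^d\to\mathbb{R}$ be a random $C$-Lipschitz function, all of them $\mathcal{F}_n$-measurable (for functions: their value at each point is $\mathcal{F}_n$-measurable). Put $\xi_i^{(0)}=z_i$ and $$\xi_i^{(\ell+1)}=\psi_\ell\Big(M_0^{(\ell)}\xi_i^{(\ell)}+M_1^{(\ell)}\frac1{|N_i|}\sum_{j\in N_i}\xi_j^{(\ell)}\Big),\qquad 0\le\ell<L,\ 1\le i\le n+1,$$ where the mean over an empty neighbourhood is $0$. Theorem. As $n\to\infty$, $$\mathbb{E}\Big[\big(y_{n+1}-g(\xi_{n+1}^{(L)})\big)^2\Big]\ \ge\ \sigma_\varepsilon^2+\frac{\sigma_x^2\sigma_\eta^2}{\sigma_x^2+\sigma_\eta^2}\,\|\beta\|^2+o(1),$$ where the left side may be $+\infty$ and the $o(1)$ is uniform over all $\beta$ with $\|\beta\|\le B$ and all such $(\psi_\ell)$,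 $(M_0^{(\ell)}),(M_1^{(\ell)})$ and $g$: for every $\delta>0$ there is $n_0$, depending only on $\delta,\alpha,\gamma,\sigma_x,\sigma_\eta,\sigma_\varepsilon,B,C_\psi,C_M,C,L$ and the sequence $(d_n)$, such that for all $n\ge n_0$ the left side plus $\delta$ is at least $\sigma_\varepsilon^2+\frac{\sigma_x^2\sigma_\eta^2}{\sigma_x^2+\sigma_\eta^2}\|\beta\|^2$. -/

import Mathlib

open MeasureTheory ProbabilityTheory Filter Asymptotics
open scoped NNReal ENNReal

noncomputable section

namespace NodeRegression

/-- Vectors of `ℝ^d` with the Euclidean norm. -/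
abbrev Vec (d : ℕ) : Type := EuclideanSpace ℝ (Fin d)

/-- The centred isotropic Gaussian law `N(0, σ² I_d)`. -/
def isoGaussian (d : ℕ) (σ : ℝ≥0) : Measure (Vec d) :=
  (stdGaussian (Vec d)).map fun v => (σ : ℝ) • v

instance (d : ℕ) (σ : ℝ≥0) : IsProbabilityMeasure (isoGaussian d σ) :=
  Measure.isProbabilityMeasure_map (Measurable.aemeasurable (by fun_prop))

/-- The Erdős–Rényi edge probability `p_n = n^(γ - 1)`, a number of `[0, 1]` for `n ≥ 1`, `γ ≤ 1`. -/
def erProb (γ : ℝ) (n : ℕ) : unitInterval :=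
  Set.projIcc 0 1 zero_le_one ((n : ℝ) ^ (γ - 1))

/-- The normalised geometric threshold `t_n = √(2 (1 - α) log n)`. -/
def geoThreshold (α : ℝ) (n : ℕ) : ℝ :=
  √(2 * (1 - α) * Real.log n)

/-- The sample space for `n` labelled nodes and one unlabelled node, the last one. A point is
`(x, η, ε, H)`: latent covariates, covariate noises, response noises, and the graph `H` of
Erdős–Rényi edges. -/
abbrev Sample (n d : ℕ) : Type :=
  (Fin (n + 1) → Vec d) × (Fin (n + 1) → Vec d) × (Fin (n + 1) → ℝ) × SimpleGraph (Fin (n + 1))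

/-- The law of the sample: the `x_i ~ N(0, σx² I)`, the `η_i ~ N(0, ση² I)`, the `ε_i ~ N(0, σε²)`
and the Erdős–Rényi edges, which are present with probability `p_n`, are all independent. -/
def sampleLaw (n d : ℕ) (σx ση σε : ℝ≥0) (γ : ℝ) : Measure (Sample n d) :=
  (Measure.pi fun _ : Fin (n + 1) => isoGaussian d σx).prod
    ((Measure.pi fun _ : Fin (n + 1) => isoGaussian d ση).prod
      ((Measure.pi fun _ : Fin (n + 1) => gaussianReal 0 (σε ^ 2)).prod
        (SimpleGraph.binomialRandom (Fin (n + 1)) (erProb γ n))))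

variable {n d : ℕ}

/-- The latent covariate `x_i`. -/
def latent (ω : Sample n d) (i : Fin (n + 1)) : Vec d := ω.1 i

/-- The observed covariate `z_i = x_i + η_i`. -/
def covariate (ω : Sample n d) (i : Fin (n + 1)) : Vec d := ω.1 i + ω.2.1 i

/-- The response `y_i = x_iᵀ β + ε_i`. -/
def response (β : Vec d) (ω : Sample n d) (i : Fin (n + 1)) : ℝ :=
  inner ℝ (latent ω i) β + ω.2.2.1 i

/-- The observed graph: distinct `i`, `j` are adjacent if `x_iᵀ x_j ≥ σx² t_n √d` (geometric edge)
or if they are joined by an Erdős–Rényi edge. -/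
def observedGraph (σx : ℝ≥0) (α : ℝ) (ω : Sample n d) : SimpleGraph (Fin (n + 1)) where
  Adj i j := i ≠ j ∧
    ((σx : ℝ) ^ 2 * geoThreshold α n * √(d : ℝ) ≤ inner ℝ (latent ω i) (latent ω j) ∨
      ω.2.2.2.Adj i j)
  symm := ⟨fun i j h => ⟨h.1.symm, h.2.imp
    (fun h' => by rwa [real_inner_comm]) (fun h' => h'.symm)⟩⟩
  loopless := ⟨fun _ h => h.1 rfl⟩

/-- The data a predictor is trained on: the responses of the `n` labelled nodes and the observed
covariates of all `n + 1` nodes. -/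
def trainingData (β : Vec d) (ω : Sample n d) : (Fin n → ℝ) × (Fin (n + 1) → Vec d) :=
  (fun i => response β ω i.castSucc, covariate ω)

/-- The `σ`-algebra `σ({y_i : i ≤ n}, {z_i : i ≤ n + 1})`. -/
abbrev trainingSigma (β : Vec d) : MeasurableSpace (Sample n d) :=
  MeasurableSpace.comap (trainingData β) inferInstance

open scoped Classical in
/-- The mean `|N_i|⁻¹ ∑_{j ∈ N_i} ξ_j` over the neighbours of `i`; it is `0` if `i` is isolated. -/
def neighborMean {V : Type*} [Fintype V] (G : SimpleGraph V) (ξ : V → Vec d) (i : V) : Vec d :=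
  ((G.neighborFinset i).card : ℝ)⁻¹ • ∑ j ∈ G.neighborFinset i, ξ j

/-- The states `ξ^(ℓ)` of the message-passing network with activations `ψ` and weights `M₀`, `M₁`
on the graph `G` with input `z`. -/
def state {V : Type*} [Fintype V] (G : SimpleGraph V) (ψ : ℕ → Vec d → Vec d)
    (M₀ M₁ : ℕ → Matrix (Fin d) (Fin d) ℝ) (z : V → Vec d) : ℕ → V → Vec d
  | 0 => z
  | ℓ + 1 => fun i =>
      ψ ℓ (Matrix.toEuclideanCLM (𝕜 := ℝ) (M₀ ℓ) (state G ψ M₀ M₁ z ℓ i) +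
        Matrix.toEuclideanCLM (𝕜 := ℝ) (M₁ ℓ) (neighborMean G (state G ψ M₀ M₁ z ℓ) i))

/-- Data-dependent activations and weights allowed for an `L`-layer network: in every layer the
activation is odd and `Cψ`-Lipschitz, both weight matrices have operator norm at most `CM`, and
all of them are measurable with respect to the training data. -/
structure IsTrainedNetwork (β : Vec d) (L : ℕ) (Cψ CM : ℝ≥0)
    (ψ : ℕ → Sample n d → Vec d → Vec d)
    (M₀ M₁ : ℕ → Sample n d → Matrix (Fin d) (Fin d) ℝ) : Prop where
  odd : ∀ ℓ < L, ∀ ω, Function.Odd (ψ ℓ ω)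
  lipschitz : ∀ ℓ < L, ∀ ω, LipschitzWith Cψ (ψ ℓ ω)
  norm_self : ∀ ℓ < L, ∀ ω, ‖Matrix.toEuclideanCLM (𝕜 := ℝ) (M₀ ℓ ω)‖ ≤ CM
  norm_neighbor : ∀ ℓ < L, ∀ ω, ‖Matrix.toEuclideanCLM (𝕜 := ℝ) (M₁ ℓ ω)‖ ≤ CM
  measurable_activation : ∀ ℓ < L, ∀ u, Measurable[trainingSigma β] fun ω => ψ ℓ ω u
  measurable_self : ∀ ℓ < L, ∀ a b, Measurable[trainingSigma β] fun ω => M₀ ℓ ω a b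
  measurable_neighbor : ∀ ℓ < L, ∀ a b, Measurable[trainingSigma β] fun ω => M₁ ℓ ω a b

/-- Data-dependent readouts: `C`-Lipschitz functions `ℝ^d → ℝ` that are measurable with respect to
the training data. -/
structure IsTrainedReadout (β : Vec d) (C : ℝ≥0) (g : Sample n d → Vec d → ℝ) : Prop where
  lipschitz : ∀ ω, LipschitzWith C (g ω)
  measurable : ∀ u, Measurable[trainingSigma β] fun ω => g ω u

/-- The prediction `g(ξ_{n+1}^(L))` for the unlabelled node, the network being run on the observed
graph with all `n + 1` nodes. -/
def prediction (σx : ℝ≥0) (α : ℝ) (L : ℕ) (ψ : ℕ → Sample n d → Vec d → Vec d)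
    (M₀ M₁ : ℕ → Sample n d → Matrix (Fin d) (Fin d) ℝ) (g : Sample n d → Vec d → ℝ)
    (ω : Sample n d) : ℝ :=
  g ω (state (observedGraph σx α ω) (fun ℓ => ψ ℓ ω) (fun ℓ => M₀ ℓ ω) (fun ℓ => M₁ ℓ ω)
    (covariate ω) L (Fin.last n))

/-- The mean squared error `E (y_{n+1} - ŷ)²` of a prediction `ŷ`, a number of `[0, ∞]`. -/
def mse (σx ση σε : ℝ≥0) (γ : ℝ) (β : Vec d) (yhat : Sample n d → ℝ) : ℝ≥0∞ :=
  ∫⁻ ω, ENNReal.ofReal ((response β ω (Fin.last n) - yhat ω) ^ 2) ∂(sampleLaw n d σx ση σε γ)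

end NodeRegression

end

/-!
Let `κ = σx² / (σx² + ση²)` and let `W = y - κ ⟨z, β⟩` be the residual of the unlabelled node. It is
a centred Gaussian variable whose variance `v` is the claimed bound. The proof gives the predictor
more than the training data: all variables of the labelled nodes, the Erdős–Rényi graph, the
covariate `z` of the unlabelled node, and the part of its latent covariate `x` orthogonal to `β`.
Since `W` is jointly Gaussian and uncorrelated with the last two, it is independent of all of this
(`indepFun_residual_revealed`), and no prediction made from the revealed information has a mean
squared error below `v`. Of what the network uses, only the observed graph is not determined by the
revealed information: the geometric edges of the unlabelled node depend on the component of `x`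
along `β`.

That dependence is negligible. Replace the observed graph by the reference graph, whose geometric
edges are formed with the orthogonal part of `x` instead of `x`; the prediction then becomes a
function of the revealed information (`measurable_referencePrediction`). The two graphs differ only
in edges at the unlabelled node, and there only in edges to labelled nodes whose inner product with
the orthogonal part of `x` is within `O(log n)` of the threshold `σx² t_n √d`. Conditionally on `x`
such an inner product is Gaussian with variance close to `σx⁴ d`, so it falls into this window with
probability `n^(-(1 - α) + o(1)) / √d` (`isoGaussian_real_near_le`), and at most
`n^(α + o(1)) / √d` edges change, with high probability. All degrees are at least `n^γ / 4` by the
Erdős–Rényi edges (`binomialRandom_real_degree_lt_le`), and all inputs have norm at most `√d` up to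
logarithms. As odd Lipschitz activations keep the states bounded by a multiple of the inputs, the
states change by at most `n^(α + o(1)) / √d * √d / n^γ`, up to a constant (`norm_state_sub_le`), which tends to `0`
because `α < γ`. These estimates hold for typical samples, whose probability tends to `1`
(`exists_sampleLaw_real_not_isTypical_le`).

The prediction may be unbounded on the atypical samples and need not have a second moment, so the
error is bounded below pointwise after a truncation (`sq_add_add_ge`): the cross term involves only
the truncated difference between `κ ⟨z, β⟩` and the reference prediction, and has expectation `0` by
independence, while the price of the truncation is controlled by the fourth moment of `W` and by
the probability of the atypical samples (`ofReal_le_lintegral_sq`).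
-/

noncomputable section

namespace NodeRegression

/-! ### Stability of message passing under changes of the graph -/

section

variable {d : ℕ} {V : Type*} [Fintype V]

open scoped Classical in
lemma norm_neighborMean_le (G : SimpleGraph V) {ξ : V → Vec d} {R : ℝ} (hR : 0 ≤ R)
    (hξ : ∀ j, ‖ξ j‖ ≤ R) (i : V) : ‖neighborMean G ξ i‖ ≤ R := by
  unfold neighborMean
  rw [norm_smul, norm_inv, Real.norm_natCast]
  have h : ‖∑ j ∈ G.neighborFinset i, ξ j‖ ≤ (G.neighborFinset i).card * R := by
    simpa using norm_sum_le_of_le (G.neighborFinset i) (fun j _ => hξ j)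
  rcases Nat.eq_zero_or_pos (G.neighborFinset i).card with h0 | h0
  · simp [h0, hR]
  · rw [inv_mul_le_iff₀ (by exact_mod_cast h0)]
    exact h

/-- Averages of the same bounded family over two large finite sets are close if the sets differ in
few points. -/
lemma norm_average_sub_average_le {ι E : Type*} [NormedAddCommGroup E] [NormedSpace ℝ E]
    [DecidableEq ι] (A B : Finset ι) {D T R : ℝ} (hD : 0 < D) (hA : D ≤ A.card) (hB : D ≤ B.card)
    (hT : ((symmDiff A B).card : ℝ) ≤ T) {ξ : ι → E} (hξ : ∀ j, ‖ξ j‖ ≤ R) (hR : 0 ≤ R) :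
    ‖(A.card : ℝ)⁻¹ • ∑ j ∈ A, ξ j - (B.card : ℝ)⁻¹ • ∑ j ∈ B, ξ j‖ ≤ 2 * R * T / D := by
  have hA0 : (0 : ℝ) < A.card := hD.trans_le hA
  have hB0 : (0 : ℝ) < B.card := hD.trans_le hB
  have hT0 : 0 ≤ T := le_trans (by positivity) hT
  have hcard : (symmDiff A B).card = (A \ B).card + (B \ A).card := by
    rw [symmDiff_def, Finset.sup_eq_union,
      Finset.card_union_of_disjoint (Finset.disjoint_left.2 (by grind))]
  have hdiff : ∑ j ∈ A, ξ j - ∑ j ∈ B, ξ j = ∑ j ∈ A \ B, ξ j - ∑ j ∈ B \ A, ξ j :=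
    Finset.sum_sdiff_sub_sum_sdiff.symm
  have hsum : ‖∑ j ∈ A, ξ j - ∑ j ∈ B, ξ j‖ ≤ R * T := by
    rw [hdiff]
    have h1 : ‖∑ j ∈ A \ B, ξ j‖ ≤ (A \ B).card * R := by
      simpa using norm_sum_le_of_le (A \ B) (fun j _ => hξ j)
    have h2 : ‖∑ j ∈ B \ A, ξ j‖ ≤ (B \ A).card * R := by
      simpa using norm_sum_le_of_le (B \ A) (fun j _ => hξ j)
    have h3 : ((A \ B).card : ℝ) + (B \ A).card ≤ T := by rw [hcard] at hT; exact_mod_cast hT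
    calc _ ≤ _ := norm_sub_le _ _
      _ ≤ ((A \ B).card + (B \ A).card) * R := by linarith
      _ ≤ R * T := by rw [mul_comm R]; gcongr
  have hcd : |(B.card : ℝ) - A.card| ≤ T := by
    have h1 : (A.card : ℝ) ≤ B.card + (A \ B).card := by
      have := Finset.card_le_card_sdiff_add_card (s := A) (t := B)
      exact_mod_cast this.trans_eq (add_comm _ _)
    have h2 : (B.card : ℝ) ≤ A.card + (B \ A).card := by
      have := Finset.card_le_card_sdiff_add_card (s := B) (t := A)
      exact_mod_cast this.trans_eq (add_comm _ _)
    have h3 : ((A \ B).card : ℝ) + (B \ A).card ≤ T := by rw [hcard] at hT; exact_mod_cast hT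
    have h4 : (0 : ℝ) ≤ (A \ B).card := by positivity
    have h5 : (0 : ℝ) ≤ (B \ A).card := by positivity
    rw [abs_le]; constructor <;> linarith
  have hsB : ‖∑ j ∈ B, ξ j‖ ≤ B.card * R := by
    simpa using norm_sum_le_of_le B (fun j _ => hξ j)
  -- Separate the change of the sum from the change of the normalisation.
  have key : (A.card : ℝ)⁻¹ • ∑ j ∈ A, ξ j - (B.card : ℝ)⁻¹ • ∑ j ∈ B, ξ j =
      (A.card : ℝ)⁻¹ • (∑ j ∈ A, ξ j - ∑ j ∈ B, ξ j) +
        (((B.card : ℝ) - A.card) / (A.card * B.card)) • ∑ j ∈ B, ξ j := by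
    have : ((B.card : ℝ) - A.card) / (A.card * B.card) = (A.card : ℝ)⁻¹ - (B.card : ℝ)⁻¹ := by
      field_simp
    rw [this, sub_smul, smul_sub]; abel
  rw [key]
  have e1 : ‖(A.card : ℝ)⁻¹ • (∑ j ∈ A, ξ j - ∑ j ∈ B, ξ j)‖ ≤ R * T / D := by
    rw [norm_smul, norm_inv, Real.norm_natCast, inv_mul_eq_div]
    gcongr
  have e2 : ‖(((B.card : ℝ) - A.card) / (A.card * B.card)) • ∑ j ∈ B, ξ j‖ ≤ R * T / D := by
    rw [norm_smul, Real.norm_eq_abs, abs_div, abs_of_pos (mul_pos hA0 hB0)]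
    calc |(B.card : ℝ) - A.card| / (A.card * B.card) * ‖∑ j ∈ B, ξ j‖
        ≤ T / (A.card * B.card) * (B.card * R) := by gcongr
      _ = R * T / A.card := by field_simp
      _ ≤ R * T / D := by gcongr
  calc _ ≤ R * T / D + R * T / D := (norm_add_le _ _).trans (add_le_add e1 e2)
    _ = 2 * R * T / D := by ring

/-- An odd function vanishes at `0`, so a Lipschitz one grows at most linearly. -/
lemma norm_lipschitz_apply_le {ψ : Vec d → Vec d} {C : ℝ≥0} (h : LipschitzWith C ψ)
    (ho : Function.Odd ψ) (v : Vec d) : ‖ψ v‖ ≤ C * ‖v‖ := by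
  have h0 : ψ 0 = 0 := by
    have := ho 0
    rw [neg_zero] at this
    have h2 : (2 : ℝ) • ψ 0 = 0 := by rw [two_smul, add_eq_zero_iff_eq_neg]; exact this
    simpa using h2
  simpa [h0] using h.norm_sub_le v 0

/-- The constant in the stability estimate `norm_state_sub_le` for the network with `ℓ` layers. -/
def stabilityConst (c : ℝ) : ℕ → ℝ
  | 0 => 0
  | ℓ + 1 => c * (2 * stabilityConst c ℓ + 2 * (2 * c) ^ ℓ)

lemma stabilityConst_nonneg {c : ℝ} (hc : 0 ≤ c) : ∀ ℓ, 0 ≤ stabilityConst c ℓ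
  | 0 => le_rfl
  | ℓ + 1 => by
    have := stabilityConst_nonneg hc ℓ
    unfold stabilityConst
    positivity

section

variable {ψ : ℕ → Vec d → Vec d} {M₀ M₁ : ℕ → Matrix (Fin d) (Fin d) ℝ} {Cψ CM : ℝ≥0}

lemma norm_state_le (G : SimpleGraph V) {z : V → Vec d} {Z : ℝ} (hZ : 0 ≤ Z)
    (hz : ∀ i, ‖z i‖ ≤ Z) (L : ℕ)
    (hodd : ∀ ℓ < L, Function.Odd (ψ ℓ)) (hlip : ∀ ℓ < L, LipschitzWith Cψ (ψ ℓ))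
    (h₀ : ∀ ℓ < L, ‖Matrix.toEuclideanCLM (𝕜 := ℝ) (M₀ ℓ)‖ ≤ CM)
    (h₁ : ∀ ℓ < L, ‖Matrix.toEuclideanCLM (𝕜 := ℝ) (M₁ ℓ)‖ ≤ CM) (i : V) :
    ‖state G ψ M₀ M₁ z L i‖ ≤ (2 * (Cψ * CM : ℝ)) ^ L * Z := by
  induction L generalizing i with
  | zero => simpa [state] using hz i
  | succ L ih =>
    have ih' := fun j => ih (fun ℓ h => hodd ℓ (h.trans (Nat.lt_succ_self _)))
      (fun ℓ h => hlip ℓ (h.trans (Nat.lt_succ_self _)))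
      (fun ℓ h => h₀ ℓ (h.trans (Nat.lt_succ_self _)))
      (fun ℓ h => h₁ ℓ (h.trans (Nat.lt_succ_self _))) j
    have hR : 0 ≤ (2 * (Cψ * CM : ℝ)) ^ L * Z := by positivity
    have hm := norm_neighborMean_le G hR ih' i
    have hL := Nat.lt_succ_self L
    simp only [state]
    calc _ ≤ _ := norm_lipschitz_apply_le (hlip L hL) (hodd L hL) _
      _ ≤ Cψ * (CM * ((2 * (Cψ * CM : ℝ)) ^ L * Z) + CM * ((2 * (Cψ * CM : ℝ)) ^ L * Z)) := by
        gcongr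
        exact (norm_add_le _ _).trans (add_le_add
          (ContinuousLinearMap.le_of_opNorm_le_of_le _ (h₀ L hL) (ih' i))
          (ContinuousLinearMap.le_of_opNorm_le_of_le _ (h₁ L hL) hm))
      _ = _ := by rw [pow_succ]; ring

open scoped Classical in
lemma norm_neighborMean_sub_le [DecidableEq V] (G G' : SimpleGraph V) {D T R e : ℝ} (hD : 0 < D)
    {i : V}
    (hdeg : D ≤ (G.neighborFinset i).card) (hdeg' : D ≤ (G'.neighborFinset i).card)
    (hT : ((symmDiff (G.neighborFinset i) (G'.neighborFinset i)).card : ℝ) ≤ T)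
    {ξ ξ' : V → Vec d} (hR : 0 ≤ R) (hξ' : ∀ j, ‖ξ' j‖ ≤ R) (he : 0 ≤ e)
    (h : ∀ j, ‖ξ j - ξ' j‖ ≤ e) :
    ‖neighborMean G ξ i - neighborMean G' ξ' i‖ ≤ e + 2 * R * T / D := by
  have h1 : neighborMean G ξ i - neighborMean G' ξ' i =
      neighborMean G (fun j => ξ j - ξ' j) i + (neighborMean G ξ' i - neighborMean G' ξ' i) := by
    simp only [neighborMean, Finset.sum_sub_distrib, smul_sub]; abel
  rw [h1]
  exact (norm_add_le _ _).trans (add_le_add (norm_neighborMean_le G he h i)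
    (norm_average_sub_average_le _ _ hD hdeg hdeg' hT hξ' hR))

open scoped Classical in
/-- Stability of the network under changes of the graph: if all degrees are at least `D`, at most
`T` edges change at every node, and the inputs are bounded by `Z`, then the states change by
`O(T Z / D)`. -/
lemma norm_state_sub_le [DecidableEq V] (G G' : SimpleGraph V) {D T Z : ℝ} (hD : 0 < D)
    (hT0 : 0 ≤ T)
    (hdeg : ∀ i, D ≤ (G.neighborFinset i).card) (hdeg' : ∀ i, D ≤ (G'.neighborFinset i).card)
    (hT : ∀ i, ((symmDiff (G.neighborFinset i) (G'.neighborFinset i)).card : ℝ) ≤ T)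
    {z : V → Vec d} (hZ : 0 ≤ Z) (hz : ∀ i, ‖z i‖ ≤ Z) (L : ℕ)
    (hodd : ∀ ℓ < L, Function.Odd (ψ ℓ)) (hlip : ∀ ℓ < L, LipschitzWith Cψ (ψ ℓ))
    (h₀ : ∀ ℓ < L, ‖Matrix.toEuclideanCLM (𝕜 := ℝ) (M₀ ℓ)‖ ≤ CM)
    (h₁ : ∀ ℓ < L, ‖Matrix.toEuclideanCLM (𝕜 := ℝ) (M₁ ℓ)‖ ≤ CM) (i : V) :
    ‖state G ψ M₀ M₁ z L i - state G' ψ M₀ M₁ z L i‖ ≤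
      stabilityConst (Cψ * CM) L * (T * Z / D) := by
  induction L generalizing i with
  | zero => simp [state, stabilityConst]
  | succ L ih =>
    have hodd' := fun ℓ (h : ℓ < L) => hodd ℓ (h.trans (Nat.lt_succ_self _))
    have hlip' := fun ℓ (h : ℓ < L) => hlip ℓ (h.trans (Nat.lt_succ_self _))
    have h₀' := fun ℓ (h : ℓ < L) => h₀ ℓ (h.trans (Nat.lt_succ_self _))
    have h₁' := fun ℓ (h : ℓ < L) => h₁ ℓ (h.trans (Nat.lt_succ_self _))
    have ih' := ih hodd' hlip' h₀' h₁'
    have hb := norm_state_le G' hZ hz L hodd' hlip' h₀' h₁'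
    have hK := stabilityConst_nonneg (c := (Cψ * CM : ℝ)) (by positivity) L
    have hm := norm_neighborMean_sub_le G G' hD (hdeg i) (hdeg' i) (hT i)
      (by positivity : 0 ≤ (2 * (Cψ * CM : ℝ)) ^ L * Z) hb (by positivity) ih'
    have hL := Nat.lt_succ_self L
    simp only [state]
    refine ((hlip L hL).norm_sub_le _ _).trans ?_
    rw [add_sub_add_comm, ← map_sub, ← map_sub]
    refine (mul_le_mul_of_nonneg_left ((norm_add_le _ _).trans (add_le_add
          (ContinuousLinearMap.le_of_opNorm_le_of_le _ (h₀ L hL) (ih' i))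
          (ContinuousLinearMap.le_of_opNorm_le_of_le _ (h₁ L hL) hm))) (by positivity)).trans
      (le_of_eq ?_)
    simp only [stabilityConst]
    ring

end

end

/-! ### Gaussian estimates -/

section

instance (d : ℕ) (σ : ℝ≥0) : IsGaussian (isoGaussian d σ) :=
  isGaussian_map (μ := stdGaussian (Vec d)) ((σ : ℝ) • ContinuousLinearMap.id ℝ (Vec d))

lemma stdGaussian_map_inner {d : ℕ} (u : Vec d) :
    (stdGaussian (Vec d)).map (fun v => inner ℝ v u) = gaussianReal 0 (‖u‖₊ ^ 2) := by
  have h := IsGaussian.map_eq_gaussianReal (μ := stdGaussian (Vec d)) (innerSL ℝ u)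
  rw [integral_strongDual_stdGaussian, variance_dual_stdGaussian, innerSL_apply_norm] at h
  convert h using 2
  · ext v; simp [real_inner_comm]
  · ext; simp

lemma isoGaussian_map_inner {d : ℕ} (σ : ℝ≥0) (u : Vec d) :
    (isoGaussian d σ).map (fun v => inner ℝ v u) = gaussianReal 0 (σ ^ 2 * ‖u‖₊ ^ 2) := by
  rw [isoGaussian, Measure.map_map (by fun_prop) (by fun_prop)]
  have : ((fun v : Vec d => inner ℝ v u) ∘ fun v => (σ : ℝ) • v) =
      fun v => inner ℝ v ((σ : ℝ) • u) := by
    ext v; simp [inner_smul_left, inner_smul_right]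
  rw [this, stdGaussian_map_inner, nnnorm_smul, mul_pow]
  simp

/-- Gaussian tail bound for the component of an isotropic Gaussian vector along a vector of norm at
most `1`. -/
lemma isoGaussian_real_inner_gt_le {d : ℕ} (σ : ℝ≥0) {u : Vec d} (hu : ‖u‖ ≤ 1) {s : ℝ}
    (hs : 0 ≤ s) :
    (isoGaussian d σ).real {x | σ * s < |inner ℝ x u|} ≤ 2 * Real.exp (-s ^ 2 / 2) := by
  have hsub : ∀ w : Vec d, ‖w‖ ≤ 1 →
      HasSubgaussianMGF (fun v : Vec d => inner ℝ v w) 1 (stdGaussian (Vec d)) := by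
    intro w hw
    have hm := stdGaussian_map_inner w
    refine ⟨fun t => ?_, fun t => ?_⟩
    · have := integrable_exp_mul_gaussianReal (μ := 0) (v := ‖w‖₊ ^ 2) t
      rw [← hm] at this
      exact this.comp_measurable (by fun_prop)
    · rw [mgf_gaussianReal hm]
      have : ‖w‖ ^ 2 ≤ 1 := by simpa using pow_le_pow_left₀ (norm_nonneg _) hw 2
      apply Real.exp_le_exp.2
      push_cast
      nlinarith [sq_nonneg t]
  have h1 := (hsub u hu).measure_ge_le hs
  have h2 := (hsub (-u) (by simpa using hu)).measure_ge_le hs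
  have : (isoGaussian d σ).real {x | σ * s < |inner ℝ x u|} ≤
      (stdGaussian (Vec d)).real ({v | s ≤ inner ℝ v u} ∪ {v | s ≤ inner ℝ v (-u)}) := by
    rw [isoGaussian, map_measureReal_apply (by fun_prop)
      (measurableSet_lt (by fun_prop) (by fun_prop))]
    refine measureReal_mono (fun v hv => ?_)
    simp only [Set.mem_preimage, Set.mem_ofPred_eq, inner_smul_left, RCLike.conj_to_real,
      abs_mul, NNReal.abs_eq, Set.mem_union, inner_neg_right] at hv ⊢
    exact le_abs.1 (lt_of_mul_lt_mul_left hv σ.2).le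
  refine this.trans ((measureReal_union_le _ _).trans ?_)
  norm_num at h1 h2 ⊢
  linarith

lemma integrable_pow_gaussianReal (v : ℝ≥0) (k : ℕ) :
    Integrable (fun x : ℝ => x ^ k) (gaussianReal 0 v) := by
  have h := (memLp_id_gaussianReal (μ := 0) (v := v) k).integrable_norm_pow'
  refine h.mono (by fun_prop) (Eventually.of_forall fun x => ?_)
  simp

/-- The squared norm of a Gaussian vector concentrates around its mean (Chebyshev). -/
lemma exists_isoGaussian_real_norm_sq_le :
    ∃ c : ℝ, 0 ≤ c ∧ ∀ (d : ℕ) (σ : ℝ≥0) (δ : ℝ), 0 < d → 0 < δ → 0 < σ →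
      (isoGaussian d σ).real {x | δ * (σ ^ 2 * d) ≤ |‖x‖ ^ 2 - σ ^ 2 * d|} ≤ c / (δ ^ 2 * d) := by
  set c : ℝ := Var[fun x : ℝ => x ^ 2; gaussianReal 0 1]
  refine ⟨c, variance_nonneg _ _, fun d σ δ hd hδ hσ => ?_⟩
  have hd' : (0 : ℝ) < d := by exact_mod_cast hd
  have hσ' : (0 : ℝ) < σ := by exact_mod_cast hσ
  have hiso : isoGaussian d σ = (Measure.pi fun _ : Fin d => gaussianReal 0 1).map
      (fun x => (σ : ℝ) • WithLp.toLp 2 x) := by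
    rw [isoGaussian, ← map_pi_eq_stdGaussian, Measure.map_map (by fun_prop) (by fun_prop)]
    rfl
  have hmem : MemLp (fun x : ℝ => x ^ 2) 2 (gaussianReal 0 1) := by
    rw [memLp_two_iff_integrable_sq (by fun_prop)]
    simp_rw [← pow_mul]
    exact integrable_pow_gaussianReal 1 4
  have hint : ∫ x : ℝ, x ^ 2 ∂(gaussianReal 0 1) = 1 := by
    have := variance_fun_id_gaussianReal (μ := 0) (v := 1)
    rw [variance_of_integral_eq_zero (by fun_prop) (by simp)] at this
    simpa using this
  have hvar : Var[∑ k : Fin d, fun x : Fin d → ℝ => (x k) ^ 2;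
      Measure.pi fun _ : Fin d => gaussianReal 0 1] = d * c := by
    rw [variance_sum_pi (X := fun _ : Fin d => fun x : ℝ => x ^ 2) (fun _ => hmem)]
    simp [c]
  have hmean : ∫ x, (∑ k : Fin d, fun x : Fin d → ℝ => (x k) ^ 2) x
      ∂(Measure.pi fun _ : Fin d => gaussianReal 0 1) = d := by
    simp only [Finset.sum_apply]
    rw [integral_finsetSum]
    · have : ∀ k : Fin d, ∫ x : Fin d → ℝ, (x k) ^ 2
          ∂(Measure.pi fun _ : Fin d => gaussianReal 0 1) = 1 := fun k => by
        rw [← hint]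
        exact integral_comp_eval (μ := fun _ : Fin d => gaussianReal 0 1) (i := k)
          (f := fun x : ℝ => x ^ 2) (by fun_prop)
      simp [this]
    · intro k _
      exact integrable_comp_eval (μ := fun _ : Fin d => gaussianReal 0 1) (i := k)
        (hmem.integrable one_le_two)
  have hmemS : MemLp (∑ k : Fin d, fun x : Fin d → ℝ => (x k) ^ 2) 2
      (Measure.pi fun _ : Fin d => gaussianReal 0 1) := by
    refine memLp_finsetSum' _ fun k _ => ?_
    exact hmem.comp_measurePreserving (measurePreserving_eval _ k)
  have hch := meas_ge_le_variance_div_sq hmemS (c := δ * d) (by positivity)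
  rw [hvar, hmean] at hch
  rw [hiso, map_measureReal_apply (by fun_prop)
    (measurableSet_le (by fun_prop) (by fun_prop))]
  have hc0 : 0 ≤ c := variance_nonneg _ _
  refine ENNReal.toReal_le_of_le_ofReal (by positivity)
    ((measure_mono ?_).trans (hch.trans_eq ?_))
  · intro x hx
    simp only [Set.mem_preimage, Set.mem_ofPred_eq, Finset.sum_apply, PiLp.smul_apply,
      smul_eq_mul, mul_pow,
      EuclideanSpace.norm_sq_eq, Real.norm_eq_abs, sq_abs, ← Finset.mul_sum] at hx ⊢
    rw [← mul_sub, abs_mul, abs_of_pos (by positivity : (0 : ℝ) < σ ^ 2)] at hx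
    exact le_of_mul_le_mul_left (by linarith) (by positivity : (0 : ℝ) < σ ^ 2)
  · congr 1
    field_simp

/-- The bound is the length of the interval `[a - r, a + r]` times the density at its left end. -/
lemma gaussianReal_real_abs_sub_le {v : ℝ≥0} (hv : v ≠ 0) {a r : ℝ} (hr : 0 ≤ r) (hra : r ≤ a) :
    (gaussianReal 0 v).real {y | |y - a| ≤ r} ≤
      2 * r * ((√(2 * Real.pi * v))⁻¹ * Real.exp (-(a - r) ^ 2 / (2 * v))) := by
  have hset : {y : ℝ | |y - a| ≤ r} = Set.Icc (a - r) (a + r) := by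
    ext y
    simp only [Set.mem_ofPred_eq, Set.mem_Icc, abs_le]
    constructor <;> intro h <;> constructor <;> linarith [h.1, h.2]
  rw [measureReal_def, gaussianReal_apply_eq_integral 0 hv, hset, ENNReal.toReal_ofReal
    (integral_nonneg fun y => gaussianPDFReal_nonneg _ _ _)]
  have hv' : (0 : ℝ) < v := by positivity
  have hb : ∀ y ∈ Set.Icc (a - r) (a + r), ‖gaussianPDFReal 0 v y‖ ≤
      (√(2 * Real.pi * v))⁻¹ * Real.exp (-(a - r) ^ 2 / (2 * v)) := by
    intro y hy
    rw [Real.norm_of_nonneg (gaussianPDFReal_nonneg _ _ _), gaussianPDFReal, sub_zero]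
    have : (a - r) ^ 2 ≤ y ^ 2 := pow_le_pow_left₀ (by linarith) hy.1 2
    gcongr
  have := norm_setIntegral_le_of_norm_le_const (μ := volume) (by simp) hb
  refine (le_abs_self _).trans (this.trans_eq ?_)
  rw [Real.volume_real_Icc_of_le (by linarith)]
  ring

/-- The fourth moment of the standard Gaussian law. -/
def gaussianFourthMoment : ℝ := ∫ x, x ^ 4 ∂(gaussianReal 0 1)

lemma gaussianFourthMoment_nonneg : 0 ≤ gaussianFourthMoment :=
  integral_nonneg fun x => by positivity

lemma integral_pow_four_gaussianReal (v : ℝ≥0) :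
    ∫ x, x ^ 4 ∂(gaussianReal 0 v) = v ^ 2 * gaussianFourthMoment := by
  have h := gaussianReal_map_const_mul (μ := 0) (v := 1) (√(v : ℝ))
  rw [mul_zero] at h
  have h3 : gaussianReal 0 v = (gaussianReal 0 1).map (fun x => √(v : ℝ) * x) := by
    rw [h]; congr 1; ext; simp
  rw [h3, integral_map (by fun_prop) (by fun_prop)]
  simp_rw [mul_pow]
  rw [integral_const_mul, gaussianFourthMoment]
  congr 1
  rw [show (4 : ℕ) = 2 * 2 from rfl, pow_mul, Real.sq_sqrt (NNReal.coe_nonneg v)]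

end

/-! ### Degrees of the binomial random graph -/

section

variable {V : Type*} [Fintype V]

open scoped Classical in
lemma measurable_card_neighborFinset (i : V) :
    Measurable fun H : SimpleGraph V => ((H.neighborFinset i).card : ℝ) := by
  have h : ∀ H : SimpleGraph V, ((H.neighborFinset i).card : ℝ) =
      ∑ j, if H.Adj i j then 1 else 0 := fun H => by
    simp [SimpleGraph.neighborFinset_eq_filter]
  simp_rw [h]
  refine Finset.measurable_sum _ fun j _ => Measurable.ite ?_ measurable_const measurable_const
  exact (SimpleGraph.measurable_iff_adj.1 measurable_id i j).setOf

open scoped Classical in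
/-- The Laplace transform of a degree of the binomial random graph at `1`: a product over the pairs
containing `i` of factors at most `1 - p / 2`. -/
lemma integral_exp_neg_degree_le (p : unitInterval) (i : V) :
    Integrable (fun H : SimpleGraph V => Real.exp (-((H.neighborFinset i).card : ℝ)))
      (SimpleGraph.binomialRandom V p) ∧
    ∫ H : SimpleGraph V, Real.exp (-((H.neighborFinset i).card : ℝ))
      ∂(SimpleGraph.binomialRandom V p) ≤
      Real.exp (-(p * ((Fintype.card V : ℝ) - 1) / 2)) := by
  set f : Sym2 V → Prop → ℝ := fun e P => if P ∧ i ∈ e ∧ ¬ e.IsDiag then Real.exp (-1) else 1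
  set μ : Sym2 V → Measure Prop := fun e =>
    unitInterval.toNNReal p • Measure.dirac (e ∈ (Sym2.diagSet (α := V))ᶜ) +
      unitInterval.toNNReal (unitInterval.symm p) • Measure.dirac False
  have hμ : ∀ e, IsProbabilityMeasure (μ e) := fun e => by infer_instance
  have hmeas : Measurable fun H : SimpleGraph V => Real.exp (-((H.neighborFinset i).card : ℝ)) := by
    have := measurable_card_neighborFinset (V := V) i
    fun_prop
  have hdeg : ∀ (P : Sym2 V → Prop) (H : SimpleGraph V), H = SimpleGraph.fromEdgeSet {e | P e} →
      Real.exp (-((H.neighborFinset i).card : ℝ)) = ∏ e, f e (P e) := by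
    intro P H hH
    have h1 : (H.neighborFinset i).card =
        (Finset.univ.filter fun e => P e ∧ i ∈ e ∧ ¬ e.IsDiag).card := by
      rw [SimpleGraph.card_neighborFinset_eq_degree, ← SimpleGraph.card_incidenceFinset_eq_degree]
      congr 1
      ext e
      simp [SimpleGraph.mem_incidenceFinset, SimpleGraph.incidenceSet, hH]
      tauto
    rw [h1, Finset.prod_ite]
    simp [← Real.exp_nat_mul]
  have hmap : SimpleGraph.binomialRandom V p =
      ((Measure.pi μ).map (fun P : Sym2 V → Prop => {e | P e})).map SimpleGraph.fromEdgeSet := by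
    rw [SimpleGraph.binomialRandom_eq_map, setBernoulli_eq_map, Measure.infinitePi_eq_pi]
  have hset : Measurable (fun P : Sym2 V → Prop => {e | P e}) :=
    MeasurableEquiv.setOfPred.measurable
  have hint : Integrable (fun H : SimpleGraph V => Real.exp (-((H.neighborFinset i).card : ℝ)))
      (SimpleGraph.binomialRandom V p) := by
    refine Integrable.of_bound hmeas.aestronglyMeasurable 1 (Eventually.of_forall fun H => ?_)
    simp
  refine ⟨hint, ?_⟩
  have h2 : ∀ e, ∫ P, f e P ∂(μ e) ≤ if i ∈ e ∧ ¬ e.IsDiag then Real.exp (-(p / 2 : ℝ)) else 1 := by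
    intro e
    have hi : ∀ ν : Measure Prop, [IsFiniteMeasure ν] → Integrable (f e) ν := fun ν _ =>
      Integrable.of_finite
    simp only [μ]
    rw [integral_add_measure (hi _) (hi _), integral_smul_nnreal_measure,
      integral_smul_nnreal_measure, integral_dirac, integral_dirac]
    simp only [f, Set.mem_compl_iff, Sym2.mem_diagSet, false_and, if_false]
    have hp1 := p.2.2
    have hp0 := p.2.1
    have hsum : (unitInterval.toNNReal p : ℝ) = p := rfl
    have hsum' : (unitInterval.toNNReal (unitInterval.symm p) : ℝ) = 1 - p := rfl
    have he : Real.exp (-1) ≤ 1 / 2 := by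
      rw [Real.exp_neg, one_div]
      exact inv_anti₀ (by norm_num) (by linarith [Real.add_one_le_exp 1])
    have hexp := Real.add_one_le_exp (-(p / 2 : ℝ))
    by_cases h : i ∈ e ∧ ¬ e.IsDiag
    · simp only [h, not_false_eq_true, and_self, if_true, NNReal.smul_def, smul_eq_mul, hsum, hsum']
      nlinarith
    · rw [if_neg (by tauto), if_neg h]
      simp [NNReal.smul_def, hsum, hsum']
  rw [hmap, integral_map (by fun_prop) hmeas.aestronglyMeasurable,
    integral_map hset.aemeasurable (by fun_prop)]
  rw [integral_congr_ae (Eventually.of_forall fun P => hdeg P _ rfl)]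
  rw [integral_fintype_prod_eq_prod (𝕜 := ℝ) f]
  have hf0 : ∀ e P, 0 ≤ f e P := fun e P => by simp only [f]; split_ifs <;> positivity
  refine (Finset.prod_le_prod (fun e _ => integral_nonneg (hf0 e)) fun e _ => h2 e).trans
    (le_of_eq ?_)
  have hcard : (Finset.univ.filter fun e : Sym2 V => i ∈ e ∧ ¬ e.IsDiag).card =
      Fintype.card V - 1 := by
    rw [← SimpleGraph.complete_graph_degree i, ← SimpleGraph.card_incidenceFinset_eq_degree]
    congr 1
    ext e
    simp [SimpleGraph.mem_incidenceFinset, SimpleGraph.incidenceSet]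
    tauto
  have hV : 1 ≤ Fintype.card V := Fintype.card_pos_iff.2 ⟨i⟩
  rw [Finset.prod_ite, Finset.prod_const_one, mul_one, Finset.prod_const, hcard, ← Real.exp_nat_mul,
    Nat.cast_sub hV]
  congr 1
  push_cast
  ring

open scoped Classical in
/-- Chernoff bound for the lower tail of a degree of the binomial random graph. -/
lemma binomialRandom_real_degree_lt_le (p : unitInterval) (i : V) (c : ℝ) :
    (SimpleGraph.binomialRandom V p).real {H | ((H.neighborFinset i).card : ℝ) < c} ≤
      Real.exp (c - p * ((Fintype.card V : ℝ) - 1) / 2) := by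
  obtain ⟨hint, hle⟩ := integral_exp_neg_degree_le p i
  have hm := mul_meas_ge_le_integral_of_nonneg (Eventually.of_forall fun H => (Real.exp_pos _).le)
    hint (Real.exp (-c))
  have : (SimpleGraph.binomialRandom V p).real {H | ((H.neighborFinset i).card : ℝ) < c} ≤
      (SimpleGraph.binomialRandom V p).real
        {H | Real.exp (-c) ≤ Real.exp (-((H.neighborFinset i).card : ℝ))} :=
    measureReal_mono fun H hH => by
      simp only [Set.mem_ofPred_eq, Real.exp_le_exp] at hH ⊢
      linarith
  refine this.trans ?_
  rw [sub_eq_add_neg, Real.exp_add, ← inv_mul_le_iff₀ (Real.exp_pos _), ← Real.exp_neg]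
  exact hm.trans hle

end

/-! ### Inner products near the threshold for geometric edges -/

section

variable {n d : ℕ}

instance (n d : ℕ) (σx ση σε : ℝ≥0) (γ : ℝ) :
    IsProbabilityMeasure (sampleLaw n d σx ση σε γ) := by
  unfold sampleLaw; infer_instance

section marginals

variable (σx ση σε : ℝ≥0) (γ : ℝ)

lemma measurePreserving_latents :
    MeasurePreserving (fun ω : Sample n d => ω.1) (sampleLaw n d σx ση σε γ)
      (Measure.pi fun _ => isoGaussian d σx) :=
  measurePreserving_fst

lemma measurePreserving_latent (i : Fin (n + 1)) :
    MeasurePreserving (fun ω : Sample n d => ω.1 i) (sampleLaw n d σx ση σε γ)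
      (isoGaussian d σx) :=
  (measurePreserving_eval (fun _ => isoGaussian d σx) i).comp
    (measurePreserving_latents σx ση σε γ)

lemma measurePreserving_noise (i : Fin (n + 1)) :
    MeasurePreserving (fun ω : Sample n d => ω.2.1 i) (sampleLaw n d σx ση σε γ)
      (isoGaussian d ση) :=
  ((measurePreserving_eval (fun _ => isoGaussian d ση) i).comp measurePreserving_fst).comp
    measurePreserving_snd

lemma measurePreserving_graph :
    MeasurePreserving (fun ω : Sample n d => ω.2.2.2) (sampleLaw n d σx ση σε γ)
      (SimpleGraph.binomialRandom (Fin (n + 1)) (erProb γ n)) :=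
  (measurePreserving_snd.comp measurePreserving_snd).comp measurePreserving_snd

lemma measurePreserving_latent_pair {i j : Fin (n + 1)} (hij : i ≠ j) :
    MeasurePreserving (fun ω : Sample n d => (ω.1 i, ω.1 j)) (sampleLaw n d σx ση σε γ)
      ((isoGaussian d σx).prod (isoGaussian d σx)) := by
  have h : MeasurePreserving (fun x : Fin (n + 1) → Vec d => (x i, x j))
      (Measure.pi fun _ => isoGaussian d σx) ((isoGaussian d σx).prod (isoGaussian d σx)) := by
    refine ⟨by fun_prop, ?_⟩
    have hind := (iIndepFun_pi (μ := fun _ : Fin (n + 1) => isoGaussian d σx)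
      (X := fun _ x => x) (fun _ => aemeasurable_id)).indepFun hij
    rw [(indepFun_iff_map_prod_eq_prod_map_map
      (measurable_pi_apply i).aemeasurable (measurable_pi_apply j).aemeasurable).1 hind]
    exact congrArg₂ _ (measurePreserving_eval (fun _ => isoGaussian d σx) i).map_eq
      (measurePreserving_eval (fun _ => isoGaussian d σx) j).map_eq
  exact h.comp (measurePreserving_latents σx ση σε γ)

end marginals

/-- Union bound over the coordinates. -/
lemma isoGaussian_real_norm_gt_le (σ : ℝ≥0) {s : ℝ} (hs : 0 ≤ s) :
    (isoGaussian d σ).real {x | σ * s * √(d : ℝ) < ‖x‖} ≤ d * (2 * Real.exp (-s ^ 2 / 2)) := by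
  have hsub : {x : Vec d | σ * s * √(d : ℝ) < ‖x‖} ⊆
      ⋃ k : Fin d, {x | σ * s < |inner ℝ x (EuclideanSpace.single k 1)|} := by
    intro x hx
    by_contra hcon
    simp only [Set.mem_iUnion, Set.mem_ofPred_eq, not_exists, not_lt,
      EuclideanSpace.inner_single_right, RCLike.conj_to_real, one_mul] at hx hcon
    refine absurd hx (not_lt.2 ?_)
    have h1 : ‖x‖ ^ 2 ≤ (σ * s * √(d : ℝ)) ^ 2 := by
      rw [EuclideanSpace.norm_sq_eq, mul_pow, Real.sq_sqrt (Nat.cast_nonneg d)]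
      calc ∑ k, ‖x k‖ ^ 2 ≤ ∑ _k : Fin d, (σ * s) ^ 2 :=
            Finset.sum_le_sum fun k _ => pow_le_pow_left₀ (norm_nonneg _) (hcon k) 2
        _ = (σ * s) ^ 2 * d := by simp [mul_comm]
    exact le_of_sq_le_sq h1 (by positivity)
  refine (measureReal_mono hsub).trans ((measureReal_iUnion_fintype_le _).trans ?_)
  refine (Finset.sum_le_sum fun k _ =>
    isoGaussian_real_inner_gt_le σ (by simp) hs).trans_eq ?_
  simp

/-- The component of `x` orthogonal to `e`, if `e` is a unit vector; it is `x` if `e = 0`. -/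
def orthPart (e x : Vec d) : Vec d := x - (inner ℝ x e : ℝ) • e

/-- The threshold above which inner products of latent covariates produce geometric edges. -/
def geoCutoff (σx : ℝ≥0) (α : ℝ) (n d : ℕ) : ℝ := (σx : ℝ) ^ 2 * geoThreshold α n * √(d : ℝ)

@[fun_prop]
lemma measurable_orthPart (e : Vec d) : Measurable (orthPart e) := by
  unfold orthPart; fun_prop

/-- Only the product of the components along `e` distinguishes `⟨x, y⟩` from
`⟨orthPart e x, y⟩`. -/
lemma inner_orthPart_add (e x y : Vec d) :
    inner ℝ x y = inner ℝ (orthPart e x) y + inner ℝ x e * inner ℝ y e := by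
  simp only [orthPart, inner_sub_left, inner_smul_left, RCLike.conj_to_real]
  rw [real_inner_comm y e]
  ring

lemma norm_orthPart_sq (e x : Vec d) :
    ‖orthPart e x‖ ^ 2 = ‖x‖ ^ 2 - (2 - ‖e‖ ^ 2) * inner ℝ x e ^ 2 := by
  rw [orthPart, norm_sub_sq_real, norm_smul, inner_smul_right, mul_pow, Real.norm_eq_abs, sq_abs]
  ring

/-- The labelled nodes whose inner product with the part of the unlabelled latent covariate
orthogonal to `e` is within `r` of the threshold for geometric edges. -/
def nearThreshold (σx : ℝ≥0) (α : ℝ) (e : Vec d) (r : ℝ) (ω : Sample n d) : Finset (Fin n) :=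
  Finset.univ.filter fun j =>
    |inner ℝ (orthPart e (latent ω (Fin.last n))) (latent ω j.castSucc) - geoCutoff σx α n d| ≤ r

/-- Markov's inequality for the number of labelled nodes near the threshold, on the event that the
latent covariate of the unlabelled node lies in `A`; conditionally on that covariate, each labelled
node is near the threshold with probability at most `q`. -/
lemma sampleLaw_real_card_nearThreshold_le (σx ση σε : ℝ≥0) (α γ : ℝ) (e : Vec d) {r τ q : ℝ}
    (hτ : 0 < τ) (hq : 0 ≤ q) {A : Set (Vec d)} (hA : MeasurableSet A)
    (h : ∀ x ∈ A, (isoGaussian d σx).real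
      {y | |inner ℝ (orthPart e x) y - geoCutoff σx α n d| ≤ r} ≤ q) :
    (sampleLaw n d σx ση σε γ).real
      {ω | latent ω (Fin.last n) ∈ A ∧ τ < (nearThreshold σx α e r ω).card} ≤ n * q / τ := by
  set ν := sampleLaw n d σx ση σε γ
  set S : Set (Vec d × Vec d) :=
    {p | p.1 ∈ A ∧ |inner ℝ (orthPart e p.1) p.2 - geoCutoff σx α n d| ≤ r}
  have hS : MeasurableSet S := (measurable_fst hA).inter
    (show MeasurableSet {p : Vec d × Vec d |
      |inner ℝ (orthPart e p.1) p.2 - geoCutoff σx α n d| ≤ r} from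
      measurableSet_le (by fun_prop) (by fun_prop))
  have hSq : ((isoGaussian d σx).prod (isoGaussian d σx)).real S ≤ q := by
    refine ENNReal.toReal_le_of_le_ofReal hq ?_
    rw [Measure.prod_apply hS]
    calc ∫⁻ x, isoGaussian d σx (Prod.mk x ⁻¹' S) ∂isoGaussian d σx
        ≤ ∫⁻ _x, ENNReal.ofReal q ∂isoGaussian d σx := by
          refine lintegral_mono fun x => ?_
          by_cases hx : x ∈ A
          · have : Prod.mk x ⁻¹' S =
                {y | |inner ℝ (orthPart e x) y - geoCutoff σx α n d| ≤ r} := by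
              ext y; simp [S, hx]
            rw [this, ← ENNReal.ofReal_toReal (measure_ne_top (isoGaussian d σx) _)]
            exact ENNReal.ofReal_le_ofReal (h x hx)
          · have : Prod.mk x ⁻¹' S = ∅ := by
              ext y; simp [S, hx]
            simp [this]
      _ = ENNReal.ofReal q := by simp
  set E : Fin n → Set (Sample n d) := fun j =>
    (fun ω : Sample n d => (ω.1 (Fin.last n), ω.1 j.castSucc)) ⁻¹' S
  have hEm : ∀ j, MeasurableSet (E j) := fun j => by
    have : Measurable (fun ω : Sample n d => (ω.1 (Fin.last n), ω.1 j.castSucc)) := by fun_prop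
    exact this hS
  have hE : ∀ j, ν.real (E j) ≤ q := fun j => by
    have := measurePreserving_latent_pair (n := n) (d := d) σx ση σε γ
      (Fin.castSucc_lt_last j).ne'
    rw [this.measureReal_preimage hS.nullMeasurableSet]
    exact hSq
  set N : Sample n d → ℝ := fun ω => ∑ j, (E j).indicator 1 ω
  have hEI : ∀ j, Integrable ((E j).indicator (1 : Sample n d → ℝ)) ν := fun j =>
    (integrable_const (1 : ℝ)).indicator (hEm j)
  have hNint : Integrable N ν := by
    exact integrable_finsetSum _ fun j _ => hEI j
  have hN0 : ∀ ω, 0 ≤ N ω := fun ω =>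
    Finset.sum_nonneg fun j _ => Set.indicator_nonneg (fun _ _ => zero_le_one) _
  have hNle : ∫ ω, N ω ∂ν ≤ n * q := by
    rw [integral_finsetSum _ fun j _ => hEI j]
    calc _ ≤ ∑ _j : Fin n, q := Finset.sum_le_sum fun j _ => by
            rw [integral_indicator_one (hEm j)]; exact hE j
      _ = n * q := by simp
  have hsub : {ω : Sample n d | latent ω (Fin.last n) ∈ A ∧ τ < (nearThreshold σx α e r ω).card} ⊆
      {ω | τ ≤ N ω} := by
    rintro ω ⟨hω, hτω⟩
    have : N ω = (nearThreshold σx α e r ω).card := by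
      simp only [N, nearThreshold, Finset.card_filter, Nat.cast_sum]
      refine Finset.sum_congr rfl fun j _ => ?_
      have hω' : ω.1 (Fin.last n) ∈ A := hω
      have hiff : ω ∈ E j ↔ |inner ℝ (orthPart e (latent ω (Fin.last n))) (latent ω j.castSucc) -
          geoCutoff σx α n d| ≤ r := by simp [E, S, latent, hω']
      by_cases hj : ω ∈ E j
      · rw [Set.indicator_of_mem hj, if_pos (hiff.1 hj)]; simp
      · rw [Set.indicator_of_notMem hj, if_neg (mt hiff.2 hj)]; simp
    rw [Set.mem_ofPred_eq, this]
    exact hτω.le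
  have hM := mul_meas_ge_le_integral_of_nonneg (Eventually.of_forall hN0) hNint τ
  rw [le_div_iff₀' hτ]
  exact (mul_le_mul_of_nonneg_left (measureReal_mono hsub) hτ.le).trans (hM.trans hNle)

/-- The probability that `⟨x, y⟩` lies close to the threshold for geometric edges, for a fixed
vector `x` and a random Gaussian vector `y`. -/
lemma isoGaussian_real_near_le {σ : ℝ≥0} (hσ : 0 < σ) {α δ : ℝ} (hδ : 0 < δ) (hδ' : δ ≤ 1 / 2)
    (hα : α < 1) (hn : 1 ≤ n) (hd : 0 < d) {r : ℝ} (hr : 0 ≤ r)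
    (hrδ : r ≤ δ * geoCutoff σ α n d) {x : Vec d} (hx : σ ^ 2 * d / 4 ≤ ‖x‖ ^ 2)
    (hx' : ‖x‖ ^ 2 ≤ (1 + δ) * (σ ^ 2 * d)) :
    (isoGaussian d σ).real {y | |inner ℝ x y - geoCutoff σ α n d| ≤ r} ≤
      4 * r / (σ ^ 2 * √(d : ℝ)) * (n : ℝ) ^ (-((1 - α) * (1 - 3 * δ))) := by
  have hd' : (0 : ℝ) < d := by exact_mod_cast hd
  have hσ' : (0 : ℝ) < σ := by exact_mod_cast hσ
  have hn' : (0 : ℝ) < n := by exact_mod_cast hn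
  have hx0 : 0 < ‖x‖ ^ 2 := lt_of_lt_of_le (by positivity) hx
  have hlog : 0 ≤ Real.log n := Real.log_nonneg (by exact_mod_cast hn)
  have hT0 : 0 ≤ geoCutoff σ α n d := by unfold geoCutoff geoThreshold; positivity
  have hTsq : geoCutoff σ α n d ^ 2 = σ ^ 4 * (2 * (1 - α) * Real.log n) * d := by
    unfold geoCutoff geoThreshold
    rw [mul_pow, mul_pow, Real.sq_sqrt hd'.le, Real.sq_sqrt]
    · ring
    · have : 0 < 1 - α := by linarith
      positivity
  set T := geoCutoff σ α n d
  have hpre : (isoGaussian d σ).real {y | |inner ℝ x y - T| ≤ r} =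
      (gaussianReal 0 (σ ^ 2 * ‖x‖₊ ^ 2)).real {t | |t - T| ≤ r} := by
    rw [← isoGaussian_map_inner, map_measureReal_apply (by fun_prop)
      (measurableSet_le (by fun_prop) (by fun_prop))]
    simp only [Set.preimage_ofPred_eq, real_inner_comm]
  have hv0 : σ ^ 2 * ‖x‖₊ ^ 2 ≠ 0 := by
    have : x ≠ 0 := by rintro rfl; simp at hx0
    exact mul_ne_zero (pow_ne_zero _ hσ.ne') (pow_ne_zero _ (nnnorm_ne_zero_iff.2 this))
  have hrT : r ≤ T := by nlinarith
  rw [hpre]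
  refine (gaussianReal_real_abs_sub_le hv0 hr hrT).trans ?_
  push_cast
  have h1 : (√(2 * Real.pi * (σ ^ 2 * ‖x‖ ^ 2)))⁻¹ ≤ 2 / (σ ^ 2 * √(d : ℝ)) := by
    rw [← one_div, div_le_div_iff₀ (by positivity) (by positivity), one_mul]
    have hle : (σ ^ 2 * √(d : ℝ) / 2) ^ 2 ≤ 2 * Real.pi * (σ ^ 2 * ‖x‖ ^ 2) := by
      have hpi := Real.pi_gt_three
      have h0 : 0 < (σ : ℝ) ^ 2 * ‖x‖ ^ 2 := by positivity
      have h2 : (σ : ℝ) ^ 2 * (σ ^ 2 * d / 4) ≤ σ ^ 2 * ‖x‖ ^ 2 := by gcongr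
      rw [div_pow, mul_pow, Real.sq_sqrt hd'.le]
      nlinarith
    have := Real.le_sqrt_of_sq_le hle
    linarith
  -- `T² / (2 σ² ‖x‖²)` is `(1 - α) log n` up to a factor close to `1`.
  have h2 : Real.exp (-(T - r) ^ 2 / (2 * (σ ^ 2 * ‖x‖ ^ 2))) ≤
      (n : ℝ) ^ (-((1 - α) * (1 - 3 * δ))) := by
    rw [Real.rpow_def_of_pos hn']
    apply Real.exp_le_exp.2
    rw [neg_div, mul_neg, neg_le_neg_iff, le_div_iff₀ (by positivity)]
    have ha : ((1 - δ) * T) ^ 2 ≤ (T - r) ^ 2 :=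
      pow_le_pow_left₀ (mul_nonneg (by linarith) hT0) (by linarith) 2
    rw [mul_pow, hTsq] at ha
    refine le_trans ?_ ha
    rcases le_or_gt (1 - 3 * δ) 0 with hneg | hpos
    · have : Real.log n * ((1 - α) * (1 - 3 * δ)) * (2 * (σ ^ 2 * ‖x‖ ^ 2)) ≤ 0 := by
        apply mul_nonpos_of_nonpos_of_nonneg _ (by positivity)
        exact mul_nonpos_of_nonneg_of_nonpos hlog
          (mul_nonpos_of_nonneg_of_nonpos (by linarith) hneg)
      refine this.trans ?_
      have : 0 < 1 - α := by linarith
      positivity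
    · have h1α : 0 < 1 - α := by linarith
      calc Real.log n * ((1 - α) * (1 - 3 * δ)) * (2 * (σ ^ 2 * ‖x‖ ^ 2))
          ≤ Real.log n * ((1 - α) * (1 - 3 * δ)) * (2 * (σ ^ 2 * ((1 + δ) * (σ ^ 2 * d)))) := by
            gcongr
        _ = ((1 - 3 * δ) * (1 + δ)) * (σ ^ 4 * (2 * (1 - α) * Real.log n) * d) := by ring
        _ ≤ (1 - δ) ^ 2 * (σ ^ 4 * (2 * (1 - α) * Real.log n) * d) := by
            gcongr
            nlinarith
  calc _ ≤ 2 * r * (2 / (σ ^ 2 * √(d : ℝ)) * (n : ℝ) ^ (-((1 - α) * (1 - 3 * δ)))) := by gcongr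
    _ = _ := by ring

end

/-! ### Typical samples and the reference prediction -/

section

variable {n d : ℕ}

/-- The sample in which the latent covariate of the unlabelled node is replaced by its part
orthogonal to `e`. -/
def removeDirection (e : Vec d) (ω : Sample n d) : Sample n d :=
  (Function.update ω.1 (Fin.last n) (orthPart e (ω.1 (Fin.last n))), ω.2)

lemma latent_removeDirection_last (e : Vec d) (ω : Sample n d) :
    latent (removeDirection e ω) (Fin.last n) = orthPart e (latent ω (Fin.last n)) := by
  simp [latent, removeDirection]

lemma latent_removeDirection_castSucc (e : Vec d) (ω : Sample n d) (j : Fin n) :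
    latent (removeDirection e ω) j.castSucc = latent ω j.castSucc := by
  simp [latent, removeDirection, (Fin.castSucc_lt_last j).ne]

open scoped Classical in
/-- A sample is typical if the covariates are bounded by `O(s √d)`, their components along `e` by
`O(s)`, all degrees are at least `D`, and at most `τ` labelled nodes have an inner product with the
unlabelled node that is close to the threshold for geometric edges. -/
structure IsTypical (σx ση : ℝ≥0) (α : ℝ) (e : Vec d) (s D τ : ℝ) (ω : Sample n d) : Prop where
  norm_latent_le : ∀ i, ‖ω.1 i‖ ≤ σx * s * √(d : ℝ)
  norm_noise_le : ∀ i, ‖ω.2.1 i‖ ≤ ση * s * √(d : ℝ)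
  abs_inner_le : ∀ i, |inner ℝ (ω.1 i) e| ≤ σx * s
  le_degree : ∀ i, D ≤ (ω.2.2.2.neighborFinset i).card
  card_nearThreshold_le : (nearThreshold σx α e ((σx * s) ^ 2) ω).card ≤ τ

section typical

variable {σx ση : ℝ≥0} {α : ℝ} {e : Vec d} {s D τ : ℝ} {ω : Sample n d}

open scoped Classical in
lemma card_neighborFinset_le_observedGraph (σx : ℝ≥0) (α : ℝ) (ω : Sample n d) (i : Fin (n + 1)) :
    ((ω.2.2.2.neighborFinset i).card : ℝ) ≤ ((observedGraph σx α ω).neighborFinset i).card := by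
  refine Nat.cast_le.2 (Finset.card_le_card fun j hj => ?_)
  rw [SimpleGraph.mem_neighborFinset] at hj ⊢
  exact ⟨hj.ne, Or.inr hj⟩

open scoped Classical in
/-- Removing the component along `e` of the unlabelled latent covariate affects only edges at the
unlabelled node, and there only edges to labelled nodes near the threshold. -/
lemma IsTypical.card_symmDiff_le (h : IsTypical σx ση α e s D τ ω) (i : Fin (n + 1)) :
    ((symmDiff ((observedGraph σx α ω).neighborFinset i)
      ((observedGraph σx α (removeDirection e ω)).neighborFinset i)).card : ℝ) ≤ τ + 1 := by
  have hτ : 0 ≤ τ := le_trans (Nat.cast_nonneg _) h.card_nearThreshold_le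
  induction i using Fin.lastCases with
  | cast i =>
    have hsub : symmDiff ((observedGraph σx α ω).neighborFinset i.castSucc)
        ((observedGraph σx α (removeDirection e ω)).neighborFinset i.castSucc) ⊆
        {Fin.last n} := by
      intro k hk
      rw [Finset.mem_singleton]
      induction k using Fin.lastCases with
      | last => rfl
      | cast k =>
        rw [Finset.mem_symmDiff, SimpleGraph.mem_neighborFinset,
          SimpleGraph.mem_neighborFinset] at hk
        simp only [observedGraph, latent_removeDirection_castSucc] at hk
        simp only [removeDirection] at hk
        tauto
    have := Finset.card_le_card hsub
    rw [Finset.card_singleton] at this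
    have : ((symmDiff ((observedGraph σx α ω).neighborFinset i.castSucc)
      ((observedGraph σx α (removeDirection e ω)).neighborFinset i.castSucc)).card : ℝ) ≤ 1 := by
      exact_mod_cast this
    linarith
  | last =>
    have hsub : symmDiff ((observedGraph σx α ω).neighborFinset (Fin.last n))
        ((observedGraph σx α (removeDirection e ω)).neighborFinset (Fin.last n)) ⊆
        (nearThreshold σx α e ((σx * s) ^ 2) ω).map Fin.castSuccEmb := by
      intro k hk
      rw [Finset.mem_symmDiff, SimpleGraph.mem_neighborFinset,
        SimpleGraph.mem_neighborFinset] at hk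
      induction k using Fin.lastCases with
      | last => simp at hk
      | cast k =>
        refine Finset.mem_map.2 ⟨k, ?_, rfl⟩
        simp only [nearThreshold, Finset.mem_filter, Finset.mem_univ, true_and]
        simp only [observedGraph, latent_removeDirection_castSucc,
          latent_removeDirection_last] at hk
        simp only [removeDirection] at hk
        have hb : |inner ℝ (latent ω (Fin.last n)) e * inner ℝ (latent ω k.castSucc) e| ≤
            (σx * s) ^ 2 := by
          rw [abs_mul, pow_two]
          exact mul_le_mul (h.abs_inner_le _) (h.abs_inner_le _) (abs_nonneg _)
            ((abs_nonneg _).trans (h.abs_inner_le 0))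
        have hin := inner_orthPart_add e (latent ω (Fin.last n)) (latent ω k.castSucc)
        rw [abs_le] at hb ⊢
        unfold geoCutoff
        rcases hk with ⟨⟨h1, h2⟩, h3⟩ | ⟨⟨h1, h2⟩, h3⟩
        · have h4 : ¬ (σx : ℝ) ^ 2 * geoThreshold α n * √(d : ℝ) ≤
              inner ℝ (orthPart e (latent ω (Fin.last n))) (latent ω k.castSucc) :=
            fun h5 => h3 ⟨h1, Or.inl h5⟩
          have h6 := h2.resolve_right fun h5 => h3 ⟨h1, Or.inr h5⟩
          constructor <;> linarith
        · have h4 : ¬ (σx : ℝ) ^ 2 * geoThreshold α n * √(d : ℝ) ≤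
              inner ℝ (latent ω (Fin.last n)) (latent ω k.castSucc) :=
            fun h5 => h3 ⟨h1, Or.inl h5⟩
          have h6 := h2.resolve_right fun h5 => h3 ⟨h1, Or.inr h5⟩
          constructor <;> linarith
    have := Finset.card_le_card hsub
    rw [Finset.card_map] at this
    have h1 := h.card_nearThreshold_le
    have h2 : ((symmDiff ((observedGraph σx α ω).neighborFinset (Fin.last n))
      ((observedGraph σx α (removeDirection e ω)).neighborFinset (Fin.last n))).card : ℝ) ≤
        (nearThreshold σx α e ((σx * s) ^ 2) ω).card := by exact_mod_cast this
    linarith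

/-- The prediction of the network run on the graph from which the influence of the component along
`e` of the latent covariate of the unlabelled node has been removed. -/
def referencePrediction (σx : ℝ≥0) (α : ℝ) (e : Vec d) (L : ℕ)
    (ψ : ℕ → Sample n d → Vec d → Vec d)
    (M₀ M₁ : ℕ → Sample n d → Matrix (Fin d) (Fin d) ℝ) (g : Sample n d → Vec d → ℝ)
    (ω : Sample n d) : ℝ :=
  g ω (state (observedGraph σx α (removeDirection e ω)) (fun ℓ => ψ ℓ ω) (fun ℓ => M₀ ℓ ω)
    (fun ℓ => M₁ ℓ ω) (covariate ω) L (Fin.last n))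

/-- On typical samples the network cannot tell the observed graph from the reference graph. -/
lemma IsTypical.abs_prediction_sub_le (h : IsTypical σx ση α e s D τ ω) (hs : 0 ≤ s) (hD : 0 < D)
    {β : Vec d} {L : ℕ} {Cψ CM C : ℝ≥0} {ψ : ℕ → Sample n d → Vec d → Vec d}
    {M₀ M₁ : ℕ → Sample n d → Matrix (Fin d) (Fin d) ℝ} {g : Sample n d → Vec d → ℝ}
    (hN : IsTrainedNetwork β L Cψ CM ψ M₀ M₁) (hg : IsTrainedReadout β C g) :
    |prediction σx α L ψ M₀ M₁ g ω - referencePrediction σx α e L ψ M₀ M₁ g ω| ≤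
      C * (stabilityConst (Cψ * CM) L * ((τ + 1) * ((σx + ση) * s * √(d : ℝ)) / D)) := by
  have hτ : 0 ≤ τ := le_trans (Nat.cast_nonneg _) h.card_nearThreshold_le
  rw [prediction, referencePrediction, ← Real.norm_eq_abs]
  refine ((hg.lipschitz ω).norm_sub_le _ _).trans (mul_le_mul_of_nonneg_left ?_ C.2)
  refine norm_state_sub_le (Cψ := Cψ) (CM := CM) _ _ hD (by positivity) (fun i => ?_) (fun i => ?_)
    h.card_symmDiff_le (by positivity) (fun i => ?_) L (fun ℓ hℓ => hN.odd ℓ hℓ ω)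
    (fun ℓ hℓ => hN.lipschitz ℓ hℓ ω) (fun ℓ hℓ => hN.norm_self ℓ hℓ ω)
    (fun ℓ hℓ => hN.norm_neighbor ℓ hℓ ω) _
  · exact (h.le_degree i).trans (card_neighborFinset_le_observedGraph σx α ω i)
  · exact (h.le_degree i).trans
      (card_neighborFinset_le_observedGraph σx α (removeDirection e ω) i)
  · refine (norm_add_le _ _).trans ?_
    have h1 := h.norm_latent_le i
    have h2 := h.norm_noise_le i
    linarith

end typical

lemma coe_erProb {γ : ℝ} (hγ : γ ≤ 1) (hn : 1 ≤ n) : (erProb γ n : ℝ) = (n : ℝ) ^ (γ - 1) := by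
  rw [erProb, Set.projIcc_of_mem]
  exact ⟨by positivity, Real.rpow_le_one_of_one_le_of_nonpos (by exact_mod_cast hn) (by linarith)⟩

lemma measureReal_exists_le {Ω ι : Type*} [MeasurableSpace Ω] [Fintype ι] (μ : Measure Ω)
    [IsFiniteMeasure μ] {p : ι → Ω → Prop} {q : ℝ} (h : ∀ i, μ.real {ω | p i ω} ≤ q) :
    μ.real {ω | ∃ i, p i ω} ≤ Fintype.card ι * q := by
  have : {ω | ∃ i, p i ω} = ⋃ i, {ω | p i ω} := by ext; simp
  rw [this]
  refine (measureReal_iUnion_fintype_le _).trans ((Finset.sum_le_sum fun i _ => h i).trans_eq ?_)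
  simp

/-- The bound on the probability that a sample is not typical. Its terms belong, in this order, to
the norms of the latent covariates, the norms of the noises, the components along `e`, the
concentration of the norm of the unlabelled latent covariate, the Erdős–Rényi degrees, and the
number of labelled nodes near the threshold. -/
def atypicalBound (c γ δ : ℝ) (n d : ℕ) : ℝ :=
  (n + 1) * (d * (2 * (n : ℝ) ^ (-4 : ℝ))) + (n + 1) * (d * (2 * (n : ℝ) ^ (-4 : ℝ))) +
    (n + 1) * (2 * (n : ℝ) ^ (-4 : ℝ)) + c / (δ ^ 2 * d) +
    (n + 1) * Real.exp (-(n : ℝ) ^ γ / 4) + 32 * Real.log n * (n : ℝ) ^ (-δ)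

/-- With `s = √(8 log n)`, degrees at least `n^γ / 4` and at most `n^(α + 4 δ) / √d` labelled nodes
near the threshold, a sample is typical with high probability. -/
lemma exists_sampleLaw_real_not_isTypical_le :
    ∃ c : ℝ, 0 ≤ c ∧ ∀ (n d : ℕ) (σx ση σε : ℝ≥0) (α γ δ : ℝ) (e : Vec d), 0 < σx → 1 ≤ n →
      0 < d → 0 < α → α < 1 → γ ≤ 1 → 0 < δ → δ ≤ 1 / 4 → ‖e‖ ≤ 1 →
      (σx : ℝ) ^ 2 * (8 * Real.log n) ≤ δ * geoCutoff σx α n d → 64 * Real.log n ≤ d →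
      (sampleLaw n d σx ση σε γ).real {ω | ¬ IsTypical σx ση α e √(8 * Real.log n)
        ((n : ℝ) ^ γ / 4) ((n : ℝ) ^ (α + 4 * δ) / √(d : ℝ)) ω} ≤ atypicalBound c γ δ n d := by
  classical
  obtain ⟨c, hc, hc'⟩ := exists_isoGaussian_real_norm_sq_le
  refine ⟨c, hc, fun n d σx ση σε α γ δ e hσx hn hd hα0 hα hγ hδ hδ' he hr hlogd => ?_⟩
  have hn' : (0 : ℝ) < n := by exact_mod_cast hn
  have hd' : (0 : ℝ) < d := by exact_mod_cast hd
  have hσ' : (0 : ℝ) < σx := by exact_mod_cast hσx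
  have hlog : 0 ≤ Real.log n := Real.log_nonneg (by exact_mod_cast hn)
  set s := √(8 * Real.log n)
  have hs : 0 ≤ s := Real.sqrt_nonneg _
  have hs2 : s ^ 2 = 8 * Real.log n := Real.sq_sqrt (by positivity)
  have hexp : Real.exp (-s ^ 2 / 2) = (n : ℝ) ^ (-4 : ℝ) := by
    rw [Real.rpow_def_of_pos hn', hs2]; congr 1; ring
  set D := (n : ℝ) ^ γ / 4
  set τ := (n : ℝ) ^ (α + 4 * δ) / √(d : ℝ)
  have hτ : 0 < τ := by positivity
  set ν := sampleLaw n d σx ση σε γ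
  -- The latent covariates for which the near-threshold probability of a labelled node is small.
  set A : Set (Vec d) :=
    {x | |‖x‖ ^ 2 - σx ^ 2 * d| < δ * (σx ^ 2 * d) ∧ |inner ℝ x e| ≤ σx * s}
  have hA : MeasurableSet A :=
    (show MeasurableSet {x : Vec d | |‖x‖ ^ 2 - σx ^ 2 * d| < δ * (σx ^ 2 * d)} from
      measurableSet_lt (by fun_prop) (by fun_prop)).inter
    (show MeasurableSet {x : Vec d | |inner ℝ x e| ≤ σx * s} from
      measurableSet_le (by fun_prop) (by fun_prop))
  set q := 4 * ((σx : ℝ) * s) ^ 2 / (σx ^ 2 * √(d : ℝ)) * (n : ℝ) ^ (-((1 - α) * (1 - 3 * δ)))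
  have hq : 0 ≤ q := by positivity
  have hB1 : ν.real {ω | ∃ i, σx * s * √(d : ℝ) < ‖ω.1 i‖} ≤
      (n + 1) * (d * (2 * (n : ℝ) ^ (-4 : ℝ))) := by
    refine (measureReal_exists_le (q := d * (2 * (n : ℝ) ^ (-4 : ℝ))) ν fun i => ?_).trans_eq
      (by simp)
    have hS : MeasurableSet {x : Vec d | σx * s * √(d : ℝ) < ‖x‖} :=
      measurableSet_lt (by fun_prop) (by fun_prop)
    have := (measurePreserving_latent (n := n) (d := d) σx ση σε γ i).measureReal_preimage
      hS.nullMeasurableSet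
    rw [← hexp]
    exact this.trans_le (isoGaussian_real_norm_gt_le σx hs)
  have hB2 : ν.real {ω | ∃ i, ση * s * √(d : ℝ) < ‖ω.2.1 i‖} ≤
      (n + 1) * (d * (2 * (n : ℝ) ^ (-4 : ℝ))) := by
    refine (measureReal_exists_le (q := d * (2 * (n : ℝ) ^ (-4 : ℝ))) ν fun i => ?_).trans_eq
      (by simp)
    have hS : MeasurableSet {x : Vec d | ση * s * √(d : ℝ) < ‖x‖} :=
      measurableSet_lt (by fun_prop) (by fun_prop)
    have := (measurePreserving_noise (n := n) (d := d) σx ση σε γ i).measureReal_preimage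
      hS.nullMeasurableSet
    rw [← hexp]
    exact this.trans_le (isoGaussian_real_norm_gt_le ση hs)
  have hB3 : ν.real {ω | ∃ i, σx * s < |inner ℝ (ω.1 i) e|} ≤
      (n + 1) * (2 * (n : ℝ) ^ (-4 : ℝ)) := by
    refine (measureReal_exists_le (q := 2 * (n : ℝ) ^ (-4 : ℝ)) ν fun i => ?_).trans_eq
      (by simp)
    have hS : MeasurableSet {x : Vec d | σx * s < |inner ℝ x e|} :=
      measurableSet_lt (by fun_prop) (by fun_prop)
    have := (measurePreserving_latent (n := n) (d := d) σx ση σε γ i).measureReal_preimage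
      hS.nullMeasurableSet
    rw [← hexp]
    exact this.trans_le (isoGaussian_real_inner_gt_le σx he hs)
  have hB4 : ν.real {ω | δ * (σx ^ 2 * d) ≤ |‖ω.1 (Fin.last n)‖ ^ 2 - σx ^ 2 * d|} ≤
      c / (δ ^ 2 * d) := by
    have hS : MeasurableSet {x : Vec d | δ * (σx ^ 2 * d) ≤ |‖x‖ ^ 2 - σx ^ 2 * d|} :=
      measurableSet_le (by fun_prop) (by fun_prop)
    have := (measurePreserving_latent (n := n) (d := d) σx ση σε γ
      (Fin.last n)).measureReal_preimage hS.nullMeasurableSet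
    exact this.trans_le (hc' d σx δ hd hδ hσx)
  have hB5 : ν.real {ω | ∃ i, ((ω.2.2.2.neighborFinset i).card : ℝ) < D} ≤
      (n + 1) * Real.exp (-(n : ℝ) ^ γ / 4) := by
    refine (measureReal_exists_le (q := Real.exp (-(n : ℝ) ^ γ / 4)) ν fun i => ?_).trans_eq
      (by simp)
    have hS : MeasurableSet {H : SimpleGraph (Fin (n + 1)) |
        ((H.neighborFinset i).card : ℝ) < D} :=
      measurableSet_lt (measurable_card_neighborFinset i) measurable_const
    have := (measurePreserving_graph (n := n) (d := d) σx ση σε γ).measureReal_preimage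
      hS.nullMeasurableSet
    refine this.trans_le ((binomialRandom_real_degree_lt_le _ i D).trans_eq ?_)
    rw [coe_erProb hγ hn, Fintype.card_fin]
    have hpow : (n : ℝ) ^ (γ - 1) * n = (n : ℝ) ^ γ := by
      rw [← Real.rpow_add_one hn'.ne', sub_add_cancel]
    congr 1
    push_cast
    rw [add_sub_cancel_right, hpow]
    ring
  have hB6 : ν.real {ω | latent ω (Fin.last n) ∈ A ∧
      τ < (nearThreshold σx α e ((σx * s) ^ 2) ω).card} ≤ n * q / τ := by
    refine sampleLaw_real_card_nearThreshold_le σx ση σε α γ e hτ hq hA fun x hx => ?_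
    obtain ⟨hx1, hx2⟩ := hx
    rw [abs_lt] at hx1
    have he2 : ‖e‖ ^ 2 ≤ 1 := by simpa using pow_le_pow_left₀ (norm_nonneg e) he 2
    have hin : inner ℝ x e ^ 2 ≤ (σx * s) ^ 2 := by
      rw [← sq_abs (inner ℝ x e)]; exact pow_le_pow_left₀ (abs_nonneg _) hx2 2
    have hin' : inner ℝ x e ^ 2 ≤ σx ^ 2 * (d / 8) := by
      refine hin.trans ?_
      rw [mul_pow, hs2]
      gcongr
      linarith
    have hσd : (0 : ℝ) < σx ^ 2 * d := by positivity
    refine isoGaussian_real_near_le hσx hδ (by linarith) hα hn hd (by positivity) ?_ ?_ ?_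
    · rw [mul_pow, hs2]; exact hr
    · rw [norm_orthPart_sq]
      nlinarith [sq_nonneg ‖e‖, sq_nonneg (inner ℝ x e : ℝ)]
    · rw [norm_orthPart_sq]
      nlinarith [sq_nonneg ‖e‖, sq_nonneg (inner ℝ x e : ℝ)]
  have hB6' : n * q / τ ≤ 32 * Real.log n * (n : ℝ) ^ (-δ) := by
    have h1 : n * q / τ = 32 * Real.log n *
        ((n : ℝ) * (n : ℝ) ^ (-((1 - α) * (1 - 3 * δ))) / (n : ℝ) ^ (α + 4 * δ)) := by
      simp only [q, τ]
      rw [mul_pow, hs2]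
      field_simp
      ring
    rw [h1]
    have h2 : (n : ℝ) * (n : ℝ) ^ (-((1 - α) * (1 - 3 * δ))) / (n : ℝ) ^ (α + 4 * δ) =
        (n : ℝ) ^ (1 + (-((1 - α) * (1 - 3 * δ))) - (α + 4 * δ)) := by
      rw [Real.rpow_sub hn', Real.rpow_add hn' 1, Real.rpow_one]
    rw [h2]
    gcongr
    · exact_mod_cast hn
    · nlinarith
  have hsub : {ω : Sample n d | ¬ IsTypical σx ση α e s D τ ω} ⊆
      {ω | ∃ i, σx * s * √(d : ℝ) < ‖ω.1 i‖} ∪ {ω | ∃ i, ση * s * √(d : ℝ) < ‖ω.2.1 i‖} ∪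
      {ω | ∃ i, σx * s < |inner ℝ (ω.1 i) e|} ∪
      {ω | δ * (σx ^ 2 * d) ≤ |‖ω.1 (Fin.last n)‖ ^ 2 - σx ^ 2 * d|} ∪
      {ω | ∃ i, ((ω.2.2.2.neighborFinset i).card : ℝ) < D} ∪
      {ω | latent ω (Fin.last n) ∈ A ∧
        τ < (nearThreshold σx α e ((σx * s) ^ 2) ω).card} := by
    intro ω hω
    by_contra hcon
    simp only [Set.mem_union, Set.mem_ofPred_eq, not_or, not_exists, not_lt, not_and] at hcon
    obtain ⟨⟨⟨⟨⟨h1, h2⟩, h3⟩, h4⟩, h5⟩, h6⟩ := hcon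
    exact hω ⟨h1, h2, h3, h5, h6 ⟨not_le.1 h4, h3 _⟩⟩
  refine (measureReal_mono hsub).trans ?_
  refine (measureReal_union_le _ _).trans (add_le_add ?_ (hB6.trans hB6'))
  refine (measureReal_union_le _ _).trans (add_le_add ?_ hB5)
  refine (measureReal_union_le _ _).trans (add_le_add ?_ hB4)
  refine (measureReal_union_le _ _).trans (add_le_add ?_ hB3)
  exact (measureReal_union_le _ _).trans (add_le_add hB1 hB2)

end

/-! ### Independence of the residual -/

section

variable {n d : ℕ}

/-- The joint law of the latent covariate, the covariate noise and the response noise of a node. -/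
def nodeLaw (d : ℕ) (σx ση σε : ℝ≥0) : Measure (Vec d × Vec d × ℝ) :=
  (isoGaussian d σx).prod ((isoGaussian d ση).prod (gaussianReal 0 (σε ^ 2)))

instance (d : ℕ) (σx ση σε : ℝ≥0) : IsGaussian (nodeLaw d σx ση σε) := by
  unfold nodeLaw; infer_instance

/-- The linear functional `(x, η, ε) ↦ ⟨x, a⟩ + (⟨η, b⟩ + ε c)`. -/
def linForm (a b : Vec d) (c : ℝ) (p : Vec d × Vec d × ℝ) : ℝ :=
  inner ℝ p.1 a + (inner ℝ p.2.1 b + p.2.2 * c)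

@[fun_prop]
lemma measurable_linForm (a b : Vec d) (c : ℝ) : Measurable (linForm a b c) := by
  unfold linForm; fun_prop

lemma prod_map_add_eq_gaussianReal {α α' : Type*} [MeasurableSpace α] [MeasurableSpace α']
    {μ : Measure α} {ν : Measure α'} [IsProbabilityMeasure μ] [IsProbabilityMeasure ν]
    {X : α → ℝ} {Y : α' → ℝ} (hX : Measurable X) (hY : Measurable Y) {v w : ℝ≥0}
    (h : μ.map X = gaussianReal 0 v) (h' : ν.map Y = gaussianReal 0 w) :
    (μ.prod ν).map (fun p => X p.1 + Y p.2) = gaussianReal 0 (v + w) := by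
  have h1 := gaussianReal_conv_gaussianReal (m₁ := 0) (m₂ := 0) (v₁ := v) (v₂ := w)
  rw [add_zero] at h1
  rw [← h1, ← h, ← h', Measure.conv, Measure.map_prod_map μ ν hX hY,
    Measure.map_map (by fun_prop) (by fun_prop)]
  rfl

lemma nodeLaw_map_linForm (σx ση σε : ℝ≥0) (a b : Vec d) (c : ℝ) :
    (nodeLaw d σx ση σε).map (linForm a b c) =
      gaussianReal 0 (σx ^ 2 * ‖a‖₊ ^ 2 + (ση ^ 2 * ‖b‖₊ ^ 2 + σε ^ 2 * ‖c‖₊ ^ 2)) := by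
  have hc : (gaussianReal 0 (σε ^ 2)).map (fun t => t * c) =
      gaussianReal 0 (σε ^ 2 * ‖c‖₊ ^ 2) := by
    rw [gaussianReal_map_mul_const, mul_zero, mul_comm]
    congr 2; ext; simp
  exact prod_map_add_eq_gaussianReal (by fun_prop) (by fun_prop) (isoGaussian_map_inner σx a)
    (prod_map_add_eq_gaussianReal (by fun_prop) (by fun_prop) (isoGaussian_map_inner ση b) hc)

lemma memLp_linForm (σx ση σε : ℝ≥0) (a b : Vec d) (c : ℝ) :
    MemLp (linForm a b c) 2 (nodeLaw d σx ση σε) := by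
  have := memLp_id_gaussianReal (μ := 0)
    (v := σx ^ 2 * ‖a‖₊ ^ 2 + (ση ^ 2 * ‖b‖₊ ^ 2 + σε ^ 2 * ‖c‖₊ ^ 2)) 2
  rw [← nodeLaw_map_linForm, memLp_map_measure_iff (by fun_prop) (by fun_prop)] at this
  exact this

lemma variance_linForm (σx ση σε : ℝ≥0) (a b : Vec d) (c : ℝ) :
    Var[linForm a b c; nodeLaw d σx ση σε] =
      σx ^ 2 * ‖a‖ ^ 2 + (ση ^ 2 * ‖b‖ ^ 2 + σε ^ 2 * c ^ 2) := by
  have := variance_id_gaussianReal (μ := 0)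
    (v := σx ^ 2 * ‖a‖₊ ^ 2 + (ση ^ 2 * ‖b‖₊ ^ 2 + σε ^ 2 * ‖c‖₊ ^ 2))
  rw [← nodeLaw_map_linForm, variance_map (by fun_prop) (by fun_prop)] at this
  simpa using this

lemma covariance_linForm (σx ση σε : ℝ≥0) (a b a' b' : Vec d) (c c' : ℝ) :
    cov[linForm a b c, linForm a' b' c'; nodeLaw d σx ση σε] =
      σx ^ 2 * inner ℝ a a' + (ση ^ 2 * inner ℝ b b' + σε ^ 2 * (c * c')) := by
  have h := variance_add (memLp_linForm σx ση σε a b c) (memLp_linForm σx ση σε a' b' c')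
  have hadd : linForm a b c + linForm a' b' c' = linForm (a + a') (b + b') (c + c') := by
    ext p; simp only [Pi.add_apply, linForm, inner_add_right]; ring
  rw [hadd, variance_linForm, variance_linForm, variance_linForm, norm_add_sq_real,
    norm_add_sq_real] at h
  linarith

/-- The slope `σx² / (σx² + ση²)` of the regression of `x` on `z = x + η`. -/
def slope (σx ση : ℝ≥0) : ℝ := (σx : ℝ) ^ 2 / ((σx : ℝ) ^ 2 + (ση : ℝ) ^ 2)

/-- The normal equation, which makes the residual uncorrelated with the covariate. -/
lemma slope_eq {σx : ℝ≥0} (hσx : 0 < σx) (ση : ℝ≥0) :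
    (1 - slope σx ση) * (σx : ℝ) ^ 2 = slope σx ση * (ση : ℝ) ^ 2 := by
  have : (0 : ℝ) < σx := by exact_mod_cast hσx
  unfold slope
  field_simp
  ring

/-- The residual variance `σε² + σx² ση² / (σx² + ση²) ‖β‖²`. -/
def residualVariance (σx ση σε : ℝ≥0) (β : Vec d) : ℝ≥0 :=
  σε ^ 2 + σx ^ 2 * ση ^ 2 / (σx ^ 2 + ση ^ 2) * ‖β‖₊ ^ 2

/-- The residual `y - κ ⟨z, β⟩` of the regression of the response of a node on its covariate, as a
function of `(x, η, ε)`. -/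
def nodeResidual (σx ση : ℝ≥0) (β : Vec d) : Vec d × Vec d × ℝ → ℝ :=
  linForm ((1 - slope σx ση) • β) ((-slope σx ση) • β) 1

@[fun_prop]
lemma measurable_nodeResidual (σx ση : ℝ≥0) (β : Vec d) : Measurable (nodeResidual σx ση β) := by
  unfold nodeResidual; fun_prop

lemma nodeLaw_map_nodeResidual {σx : ℝ≥0} (hσx : 0 < σx) (ση σε : ℝ≥0) (β : Vec d) :
    (nodeLaw d σx ση σε).map (nodeResidual σx ση β) =
      gaussianReal 0 (residualVariance σx ση σε β) := by
  rw [nodeResidual, nodeLaw_map_linForm]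
  congr 1
  have h := slope_eq hσx ση
  have : (0 : ℝ) < σx := by exact_mod_cast hσx
  ext
  simp only [residualVariance, nnnorm_smul, NNReal.coe_add, NNReal.coe_mul, NNReal.coe_pow,
    coe_nnnorm, mul_pow, Real.norm_eq_abs, sq_abs, NNReal.coe_div, neg_sq, nnnorm_one,
    one_pow, mul_one]
  have h2 : (σx : ℝ) ^ 2 * (ση : ℝ) ^ 2 / ((σx : ℝ) ^ 2 + (ση : ℝ) ^ 2) =
      slope σx ση * (ση : ℝ) ^ 2 := by unfold slope; ring
  rw [h2]
  linear_combination (1 - slope σx ση) * ‖β‖ ^ 2 * h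

/-- The residual of a node is independent of its covariate and of the part of its latent covariate
orthogonal to `β`: they are jointly Gaussian and uncorrelated. -/
lemma indepFun_nodeResidual {σx : ℝ≥0} (hσx : 0 < σx) (ση σε : ℝ≥0) {β e : Vec d}
    (he : ∀ u, inner ℝ (orthPart e u) β = 0) :
    IndepFun (nodeResidual σx ση β)
      (fun p : Vec d × Vec d × ℝ => (p.1 + p.2.1, orthPart e p.1)) (nodeLaw d σx ση σε) := by
  let A : (Vec d × Vec d × ℝ) →L[ℝ] ℝ × (Vec d × Vec d) :=
    { toFun := fun p => (nodeResidual σx ση β p, (p.1 + p.2.1, orthPart e p.1))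
      map_add' := fun p q => by
        simp only [nodeResidual, linForm, orthPart, Prod.fst_add, Prod.snd_add, inner_add_left,
          Prod.mk_add_mk, Prod.mk.injEq]
        refine ⟨by ring, by abel, ?_⟩
        rw [add_smul]; abel
      map_smul' := fun c p => by
        simp only [nodeResidual, linForm, orthPart, Prod.smul_fst, Prod.smul_snd, inner_smul_left,
          RCLike.conj_to_real, RingHom.id_apply, Prod.smul_mk, Prod.mk.injEq, smul_eq_mul,
          smul_add, smul_sub, mul_smul, and_true]
        ring
      cont := by unfold nodeResidual linForm orthPart; fun_prop }
  have hA : HasGaussianLaw (fun p => (nodeResidual σx ση β p, (p.1 + p.2.1, orthPart e p.1)))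
      (nodeLaw d σx ση σε) :=
    (IsGaussian.hasGaussianLaw_id (μ := nodeLaw d σx ση σε)).map A
  refine hA.indepFun_of_covariance_strongDual fun L₁ L₂ => ?_
  set u := (InnerProductSpace.toDual ℝ (Vec d)).symm (L₂.comp (.inl ℝ _ _))
  set v := (InnerProductSpace.toDual ℝ (Vec d)).symm (L₂.comp (.inr ℝ _ _))
  have h1 : L₁ ∘ nodeResidual σx ση β = fun p => L₁ 1 * nodeResidual σx ση β p := by
    ext p
    rw [Function.comp_apply, mul_comm, ← smul_eq_mul, ← map_smul, smul_eq_mul, mul_one]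
  have h2 : L₂ ∘ (fun p : Vec d × Vec d × ℝ => (p.1 + p.2.1, orthPart e p.1)) =
      linForm (u + orthPart e v) u 0 := by
    ext p
    have h3 : L₂ (p.1 + p.2.1, orthPart e p.1) =
        inner ℝ u (p.1 + p.2.1) + inner ℝ v (orthPart e p.1) := by
      simp only [u, v, InnerProductSpace.toDual_symm_apply, ContinuousLinearMap.comp_apply,
        ContinuousLinearMap.inl_apply, ContinuousLinearMap.inr_apply]
      rw [← map_add, Prod.mk_add_mk, add_zero, zero_add]
    rw [Function.comp_apply, h3]
    simp only [linForm, orthPart, inner_add_right, inner_sub_right, inner_smul_right,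
      real_inner_comm]
    ring
  rw [h1, h2, covariance_const_mul_left, nodeResidual, covariance_linForm]
  simp only [inner_smul_left, inner_add_right, RCLike.conj_to_real, mul_zero, add_zero]
  rw [real_inner_comm (orthPart e v) β, he]
  have := slope_eq hσx ση
  linear_combination L₁ 1 * inner ℝ β u * this

lemma measurePreserving_prodProdProdComm {α β γ δ : Type*} [MeasurableSpace α]
    [MeasurableSpace β] [MeasurableSpace γ] [MeasurableSpace δ] (a : Measure α) (b : Measure β)
    (c : Measure γ) (e : Measure δ) [SFinite a] [SFinite b] [SFinite c] [SFinite e] :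
    MeasurePreserving (fun p : (α × β) × (γ × δ) => ((p.1.1, p.2.1), (p.1.2, p.2.2)))
      ((a.prod b).prod (c.prod e)) ((a.prod c).prod (b.prod e)) := by
  have h1 := measurePreserving_prodAssoc a b (c.prod e)
  have h2 := (MeasurePreserving.id a).prod (measurePreserving_prodAssoc b c e).symm
  have h3 := (MeasurePreserving.id a).prod
    ((Measure.measurePreserving_swap (μ := b) (ν := c)).prod (MeasurePreserving.id e))
  have h4 := (MeasurePreserving.id a).prod (measurePreserving_prodAssoc c b e)
  have h5 := (measurePreserving_prodAssoc a c (b.prod e)).symm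
  exact h5.comp (h4.comp (h3.comp (h2.comp h1)))

/-- Splitting off the last of `n + 1` independent variables. -/
lemma measurePreserving_splitLast {E : Type*} [MeasurableSpace E] (μ : Measure E)
    [IsProbabilityMeasure μ] (n : ℕ) :
    MeasurePreserving (fun x : Fin (n + 1) → E => (x (Fin.last n), fun j : Fin n => x j.castSucc))
      (Measure.pi fun _ => μ) (μ.prod (Measure.pi fun _ => μ)) := by
  have := measurePreserving_piFinSuccAbove (fun _ : Fin (n + 1) => μ) (Fin.last n)
  convert this using 1
  ext x : 1
  simp [MeasurableEquiv.piFinSuccAbove, Fin.insertNthEquiv]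
  rfl

/-- The variables of the labelled nodes together with the Erdős–Rényi graph. -/
abbrev LabelledSample (n d : ℕ) : Type :=
  (Fin n → Vec d) × (Fin n → Vec d) × (Fin n → ℝ) × SimpleGraph (Fin (n + 1))

/-- The law of the variables of the labelled nodes and of the Erdős–Rényi graph. -/
def labelledLaw (n d : ℕ) (σx ση σε : ℝ≥0) (γ : ℝ) : Measure (LabelledSample n d) :=
  (Measure.pi fun _ => isoGaussian d σx).prod
    ((Measure.pi fun _ => isoGaussian d ση).prod
      ((Measure.pi fun _ => gaussianReal 0 (σε ^ 2)).prod
        (SimpleGraph.binomialRandom (Fin (n + 1)) (erProb γ n))))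

instance (n d : ℕ) (σx ση σε : ℝ≥0) (γ : ℝ) :
    IsProbabilityMeasure (labelledLaw n d σx ση σε γ) := by
  unfold labelledLaw; infer_instance

/-- The variables `(x, η, ε)` of the unlabelled node. -/
def lastNode (ω : Sample n d) : Vec d × Vec d × ℝ :=
  (ω.1 (Fin.last n), ω.2.1 (Fin.last n), ω.2.2.1 (Fin.last n))

/-- The variables of the labelled nodes and the Erdős–Rényi graph. -/
def labelled (ω : Sample n d) : LabelledSample n d :=
  (fun j => ω.1 j.castSucc, fun j => ω.2.1 j.castSucc, fun j => ω.2.2.1 j.castSucc, ω.2.2.2)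

/-- The variables of the unlabelled node are independent of all the others. -/
lemma measurePreserving_split (n d : ℕ) (σx ση σε : ℝ≥0) (γ : ℝ) :
    MeasurePreserving (fun ω : Sample n d => (lastNode ω, labelled ω))
      (sampleLaw n d σx ση σε γ) ((nodeLaw d σx ση σε).prod (labelledLaw n d σx ση σε γ)) := by
  have hε := (measurePreserving_prodAssoc _ _ _).comp
    ((measurePreserving_splitLast (gaussianReal 0 (σε ^ 2)) n).prod
      (MeasurePreserving.id (SimpleGraph.binomialRandom (Fin (n + 1)) (erProb γ n))))
  have hη := (measurePreserving_prodProdProdComm _ _ _ _).comp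
    ((measurePreserving_splitLast (isoGaussian d ση) n).prod hε)
  exact (measurePreserving_prodProdProdComm _ _ _ _).comp
    ((measurePreserving_splitLast (isoGaussian d σx) n).prod hη)

/-- The information revealed to the predictor: all variables of the labelled nodes, the
Erdős–Rényi graph, the covariate of the unlabelled node, and the part of its latent covariate
orthogonal to `e`. -/
def revealed (e : Vec d) (ω : Sample n d) : (Vec d × Vec d) × LabelledSample n d :=
  ((covariate ω (Fin.last n), orthPart e (latent ω (Fin.last n))), labelled ω)

/-- The residual `y - κ ⟨z, β⟩` of the unlabelled node. -/
def residual (σx ση : ℝ≥0) (β : Vec d) (ω : Sample n d) : ℝ := nodeResidual σx ση β (lastNode ω)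

/-- The response of the unlabelled node is its regression on the covariate plus the residual. -/
lemma response_last_eq (σx ση : ℝ≥0) (β : Vec d) (ω : Sample n d) :
    response β ω (Fin.last n) =
      slope σx ση * inner ℝ (covariate ω (Fin.last n)) β + residual σx ση β ω := by
  simp only [response, latent, residual, nodeResidual, linForm, lastNode, covariate,
    inner_smul_right, inner_add_left]
  ring

@[fun_prop]
lemma measurable_lastNode : Measurable (lastNode (n := n) (d := d)) := by
  unfold lastNode; fun_prop

@[fun_prop]
lemma measurable_labelled : Measurable (labelled (n := n) (d := d)) := by
  unfold labelled; fun_prop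

@[fun_prop]
lemma measurable_revealed (e : Vec d) : Measurable (revealed (n := n) e) := by
  unfold revealed covariate latent; fun_prop

@[fun_prop]
lemma measurable_residual (σx ση : ℝ≥0) (β : Vec d) :
    Measurable (residual (n := n) σx ση β) := by
  unfold residual; fun_prop

lemma sampleLaw_map_residual {σx : ℝ≥0} (hσx : 0 < σx) (ση σε : ℝ≥0) (γ : ℝ) (β : Vec d) :
    (sampleLaw n d σx ση σε γ).map (residual σx ση β) =
      gaussianReal 0 (residualVariance σx ση σε β) := by
  have h : MeasurePreserving (lastNode (n := n) (d := d)) (sampleLaw n d σx ση σε γ)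
      (nodeLaw d σx ση σε) := measurePreserving_fst.comp (measurePreserving_split n d σx ση σε γ)
  rw [← nodeLaw_map_nodeResidual hσx, ← h.map_eq, Measure.map_map (by fun_prop) (by fun_prop)]
  rfl

/-- The residual of the unlabelled node is independent of the revealed information. -/
lemma indepFun_residual_revealed {σx : ℝ≥0} (hσx : 0 < σx) (ση σε : ℝ≥0) (γ : ℝ) {β e : Vec d}
    (he : ∀ u, inner ℝ (orthPart e u) β = 0) :
    IndepFun (residual σx ση β) (revealed e) (sampleLaw n d σx ση σε γ) := by
  set θ : Vec d × Vec d × ℝ → Vec d × Vec d := fun p => (p.1 + p.2.1, orthPart e p.1)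
  have hθ : Measurable θ := by fun_prop
  have hsplit := measurePreserving_split n d σx ση σε γ
  have hnode := (indepFun_iff_map_prod_eq_prod_map_map (by fun_prop) hθ.aemeasurable).1
    (indepFun_nodeResidual hσx ση σε he)
  have h1 : MeasurePreserving (fun p => (nodeResidual σx ση β p, θ p)) (nodeLaw d σx ση σε)
      (((nodeLaw d σx ση σε).map (nodeResidual σx ση β)).prod ((nodeLaw d σx ση σε).map θ)) :=
    ⟨by fun_prop, hnode⟩
  have : IsProbabilityMeasure ((nodeLaw d σx ση σε).map (nodeResidual σx ση β)) :=
    Measure.isProbabilityMeasure_map (by fun_prop)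
  have : IsProbabilityMeasure ((nodeLaw d σx ση σε).map θ) :=
    Measure.isProbabilityMeasure_map hθ.aemeasurable
  have h2 := ((measurePreserving_prodAssoc _ _ _).comp
    (h1.prod (MeasurePreserving.id (labelledLaw n d σx ση σε γ)))).comp hsplit
  have h3 : MeasurePreserving (fun ω : Sample n d => (residual σx ση β ω, revealed e ω))
      (sampleLaw n d σx ση σε γ) (((nodeLaw d σx ση σε).map (nodeResidual σx ση β)).prod
        (((nodeLaw d σx ση σε).map θ).prod (labelledLaw n d σx ση σε γ))) := h2
  rw [indepFun_iff_map_prod_eq_prod_map_map (by fun_prop) (by fun_prop), h3.map_eq]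
  congr 1
  · exact (measurePreserving_fst.comp h3).map_eq.symm
  · exact (measurePreserving_snd.comp h3).map_eq.symm

end

/-! ### Measurability of the reference prediction -/

section

variable {n d : ℕ}

section measurability

variable {Ω : Type*} {m : MeasurableSpace Ω} {V : Type*} [Fintype V]

open scoped Classical in
lemma measurable_neighborMean {G : Ω → SimpleGraph V}
    (hG : ∀ i j, Measurable fun ω => (G ω).Adj i j)
    {ξ : Ω → V → Vec d} (hξ : ∀ j, Measurable fun ω => ξ ω j) (i : V) :
    Measurable fun ω => neighborMean (G ω) (ξ ω) i := by
  have h1 : Measurable fun ω => (((G ω).neighborFinset i).card : ℝ) :=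
    (measurable_card_neighborFinset i).comp (SimpleGraph.measurable_iff_adj.2 hG)
  have h2 : ∀ ω, ∑ j ∈ (G ω).neighborFinset i, ξ ω j = ∑ j, if (G ω).Adj i j then ξ ω j else 0 :=
    fun ω => by rw [SimpleGraph.neighborFinset_eq_filter, Finset.sum_filter]
  simp only [neighborMean, h2]
  refine h1.inv.smul (Finset.measurable_sum _ fun j _ => ?_)
  exact Measurable.ite (hG i j).setOf (hξ j) measurable_const

lemma measurable_toEuclideanCLM_apply {M : Ω → Matrix (Fin d) (Fin d) ℝ}
    (hM : ∀ a b, Measurable fun ω => M ω a b) {v : Ω → Vec d} (hv : Measurable v) :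
    Measurable fun ω => Matrix.toEuclideanCLM (𝕜 := ℝ) (M ω) (v ω) := by
  have h : ∀ ω, Matrix.toEuclideanCLM (𝕜 := ℝ) (M ω) (v ω) =
      WithLp.toLp 2 (fun a => ∑ b, M ω a b * v ω b) := fun ω => by
    ext a
    rw [Matrix.ofLp_toEuclideanCLM]
    rfl
  simp_rw [h]
  have : Measurable fun ω => fun a => ∑ b, M ω a b * v ω b :=
    measurable_pi_lambda _ fun a => Finset.measurable_sum _ fun b _ => by
      have := hM a b
      fun_prop
  fun_prop

/-- A random Lipschitz function is jointly measurable (a Carathéodory function), so it may be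
evaluated at a random point. -/
lemma measurable_apply_of_lipschitz {E : Type*} [PseudoMetricSpace E] [MeasurableSpace E]
    [BorelSpace E] {f : Ω → Vec d → E} {C : ℝ≥0} (hf : ∀ ω, LipschitzWith C (f ω))
    (hm : ∀ u, Measurable fun ω => f ω u) {v : Ω → Vec d} (hv : Measurable v) :
    Measurable fun ω => f ω (v ω) :=
  (measurable_uncurry_of_continuous_of_measurable (u := fun u ω => f ω u)
    (fun ω => (hf ω).continuous) hm).comp (hv.prodMk measurable_id)

lemma measurable_state {G : Ω → SimpleGraph V} (hG : ∀ i j, Measurable fun ω => (G ω).Adj i j)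
    {ψ : ℕ → Ω → Vec d → Vec d} {M₀ M₁ : ℕ → Ω → Matrix (Fin d) (Fin d) ℝ} {Cψ : ℝ≥0}
    {z : Ω → V → Vec d} (hz : ∀ i, Measurable fun ω => z ω i) (L : ℕ)
    (hlip : ∀ ℓ < L, ∀ ω, LipschitzWith Cψ (ψ ℓ ω))
    (hψ : ∀ ℓ < L, ∀ u, Measurable fun ω => ψ ℓ ω u)
    (h₀ : ∀ ℓ < L, ∀ a b, Measurable fun ω => M₀ ℓ ω a b)
    (h₁ : ∀ ℓ < L, ∀ a b, Measurable fun ω => M₁ ℓ ω a b) (i : V) :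
    Measurable fun ω => state (G ω) (fun ℓ => ψ ℓ ω) (fun ℓ => M₀ ℓ ω) (fun ℓ => M₁ ℓ ω) (z ω)
      L i := by
  induction L generalizing i with
  | zero => exact hz i
  | succ L ih =>
    have ih' := ih (fun ℓ h => hlip ℓ (h.trans (Nat.lt_succ_self _)))
      (fun ℓ h => hψ ℓ (h.trans (Nat.lt_succ_self _)))
      (fun ℓ h => h₀ ℓ (h.trans (Nat.lt_succ_self _)))
      (fun ℓ h => h₁ ℓ (h.trans (Nat.lt_succ_self _)))
    have hL := Nat.lt_succ_self L
    exact measurable_apply_of_lipschitz (hlip L hL) (hψ L hL)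
      ((measurable_toEuclideanCLM_apply (h₀ L hL) (ih' i)).add
        (measurable_toEuclideanCLM_apply (h₁ L hL) (measurable_neighborMean hG ih' i)))

lemma measurable_ne_and_le_inner_or {ι : Type*} {x y : Ω → Vec d} (hx : Measurable x)
    (hy : Measurable y) {P : Ω → Prop} (hP : Measurable P) (c : ℝ) (i j : ι) :
    Measurable fun ω => i ≠ j ∧ (c ≤ inner ℝ (x ω) (y ω) ∨ P ω) := by
  refine Measurable.and measurable_const (Measurable.or ?_ hP)
  exact measurableSet_setOfPred.1 (measurableSet_le measurable_const (hx.inner hy))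

lemma measurable_prodMk_pi {ι κ E F : Type*} [MeasurableSpace E] [MeasurableSpace F]
    {f : Ω → ι → E} {g : Ω → κ → F} (hf : ∀ i, Measurable fun ω => f ω i)
    (hg : ∀ k, Measurable fun ω => g ω k) : Measurable fun ω => (f ω, g ω) :=
  (measurable_pi_lambda _ hf).prodMk (measurable_pi_lambda _ hg)

end measurability

/-- The `σ`-algebra of the revealed information. -/
abbrev revealedSigma (e : Vec d) : MeasurableSpace (Sample n d) :=
  MeasurableSpace.comap (revealed e) inferInstance

lemma measurable_of_revealed {β : Type*} [MeasurableSpace β] (e : Vec d)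
    {f : (Vec d × Vec d) × LabelledSample n d → β} (hf : Measurable f) :
    Measurable[revealedSigma e] fun ω : Sample n d => f (revealed e ω) :=
  hf.comp (comap_measurable _)

lemma measurable_revealed_covariate (e : Vec d) (i : Fin (n + 1)) :
    Measurable[revealedSigma e] fun ω : Sample n d => covariate ω i := by
  induction i using Fin.lastCases with
  | last => exact measurable_of_revealed (n := n) e (f := fun p => p.1.1) (by fun_prop)
  | cast i =>
    exact measurable_of_revealed (n := n) e (f := fun p => p.2.1 i + p.2.2.1 i) (by fun_prop)

lemma measurable_revealed_latent (e : Vec d) (i : Fin (n + 1)) :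
    Measurable[revealedSigma e] fun ω : Sample n d => latent (removeDirection e ω) i := by
  induction i using Fin.lastCases with
  | last =>
    simp_rw [latent_removeDirection_last]
    exact measurable_of_revealed (n := n) e (f := fun p => p.1.2) (by fun_prop)
  | cast i =>
    simp_rw [latent_removeDirection_castSucc]
    exact measurable_of_revealed (n := n) e (f := fun p => p.2.1 i) (by fun_prop)

lemma measurable_revealed_observedGraph (σx : ℝ≥0) (α : ℝ) (e : Vec d) (i j : Fin (n + 1)) :
    Measurable[revealedSigma e] fun ω : Sample n d =>
      (observedGraph σx α (removeDirection e ω)).Adj i j := by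
  have hi := measurable_revealed_latent (n := n) e i
  have hj := measurable_revealed_latent (n := n) e j
  have hH : Measurable[revealedSigma e] fun ω : Sample n d => ω.2.2.2.Adj i j := by
    refine measurable_of_revealed (n := n) e (f := fun p => p.2.2.2.2.Adj i j) ?_
    exact (SimpleGraph.measurable_iff_adj.1 measurable_id i j).comp (by fun_prop)
  exact measurable_ne_and_le_inner_or hi hj hH _ i j

/-- The training data are part of the revealed information. -/
lemma trainingSigma_le_revealedSigma (β e : Vec d) :
    trainingSigma (n := n) β ≤ revealedSigma e := by
  rw [← measurable_iff_comap_le]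
  refine measurable_prodMk_pi (m := revealedSigma e) (fun i => ?_)
    (measurable_revealed_covariate e)
  exact measurable_of_revealed (n := n) e (f := fun p => inner ℝ (p.2.1 i) β + p.2.2.2.1 i)
    (by fun_prop)

/-- The reference prediction is a function of the revealed information. -/
lemma measurable_referencePrediction (σx : ℝ≥0) (α : ℝ) {β : Vec d} (e : Vec d) {L : ℕ}
    {Cψ CM C : ℝ≥0} {ψ : ℕ → Sample n d → Vec d → Vec d}
    {M₀ M₁ : ℕ → Sample n d → Matrix (Fin d) (Fin d) ℝ} {g : Sample n d → Vec d → ℝ}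
    (hN : IsTrainedNetwork β L Cψ CM ψ M₀ M₁) (hg : IsTrainedReadout β C g) :
    Measurable[revealedSigma e] (referencePrediction σx α e L ψ M₀ M₁ g) := by
  have hle := trainingSigma_le_revealedSigma (n := n) β e
  refine measurable_apply_of_lipschitz (m := revealedSigma e) hg.lipschitz
    (fun u => (hg.measurable u).mono hle le_rfl) ?_
  exact measurable_state (m := revealedSigma e) (measurable_revealed_observedGraph σx α e)
    (measurable_revealed_covariate e) L hN.lipschitz
    (fun ℓ hℓ u => (hN.measurable_activation ℓ hℓ u).mono hle le_rfl)
    (fun ℓ hℓ a b => (hN.measurable_self ℓ hℓ a b).mono hle le_rfl)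
    (fun ℓ hℓ a b => (hN.measurable_neighbor ℓ hℓ a b).mono hle le_rfl) _

end

/-! ### A lower bound for the mean squared error -/

section

variable {Ω : Type*} [MeasurableSpace Ω]

/-- The right side is the integral of the positive part of `R`. -/
lemma ofReal_integral_le_lintegral_ofReal {ν : Measure Ω} {R : Ω → ℝ} (hR : Integrable R ν) :
    ENNReal.ofReal (∫ ω, R ω ∂ν) ≤ ∫⁻ ω, ENNReal.ofReal (R ω) ∂ν := by
  rw [integral_eq_lintegral_pos_part_sub_lintegral_neg_part hR]
  refine (ENNReal.ofReal_le_ofReal (sub_le_self _ ENNReal.toReal_nonneg)).trans ?_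
  exact ENNReal.ofReal_toReal_le

/-- A pointwise lower bound for `(A + W + D)²` in terms of the truncation of `A` at `±(M + 1)`. The
number `t ∈ {0, 1}` is the indicator of the event that `D` is out of control. -/
lemma sq_add_add_ge {A W D η M t : ℝ} (hM : 1 ≤ M) (hη : η ≤ 1) (hη0 : 0 ≤ η)
    (ht : t = 1 ∨ t = 0 ∧ |D| ≤ η) :
    W ^ 2 + 2 * (max (-(M + 1)) (min (M + 1) A) * W) - η * (1 + W ^ 2) - 5 * M ^ 2 * t -
      5 / M ^ 2 * W ^ 4 ≤ (A + W + D) ^ 2 := by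
  set A' := max (-(M + 1)) (min (M + 1) A)
  have hA1 : A' ≤ M + 1 := max_le (by linarith) (min_le_left _ _)
  have hA2 : -(M + 1) ≤ A' := le_max_left _ _
  have hAW : A' * W ≤ (M + 1) * |W| := by
    calc A' * W ≤ |A' * W| := le_abs_self _
      _ = |A'| * |W| := abs_mul _ _
      _ ≤ (M + 1) * |W| := by gcongr; exact abs_le.2 ⟨hA2, hA1⟩
  have hW0 := abs_nonneg W
  have hWsq : W ^ 2 = |W| ^ 2 := (sq_abs W).symm
  have hW4 : W ^ 4 = |W| ^ 4 := by rw [← abs_pow, abs_of_nonneg (by positivity)]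
  have hM2 : 0 < M ^ 2 := by positivity
  have ht0 : 0 ≤ t := by rcases ht with h | h <;> linarith [h]
  have h4 : 0 ≤ 5 / M ^ 2 * W ^ 4 := by positivity
  have hηW : 0 ≤ η * (1 + W ^ 2) := by positivity
  have hsq := sq_nonneg (A + W + D)
  -- If `|W| > M`, the fourth power of `W` dominates the left side.
  rcases lt_or_ge M |W| with hW | hW
  · have h1 : M ^ 2 * (W ^ 2 + 2 * ((M + 1) * |W|)) ≤ 5 * W ^ 4 := by
      rw [hWsq, hW4]
      have h2 : M ^ 2 ≤ |W| ^ 2 := pow_le_pow_left₀ (by linarith) hW.le 2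
      have h3 : M ^ 3 ≤ |W| ^ 3 := pow_le_pow_left₀ (by linarith) hW.le 3
      have h5 : M ^ 2 * |W| ^ 2 ≤ |W| ^ 2 * |W| ^ 2 := by gcongr
      have h6 : M ^ 2 * (2 * ((M + 1) * |W|)) ≤ 4 * (|W| ^ 3 * |W|) := by
        calc M ^ 2 * (2 * ((M + 1) * |W|)) ≤ M ^ 2 * (2 * ((M + M) * |W|)) := by gcongr
          _ = 4 * (M ^ 3 * |W|) := by ring
          _ ≤ 4 * (|W| ^ 3 * |W|) := by gcongr
      nlinarith
    have h7 : W ^ 2 + 2 * ((M + 1) * |W|) ≤ 5 / M ^ 2 * W ^ 4 := by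
      rw [div_mul_eq_mul_div, le_div_iff₀ hM2]; linarith
    have : 0 ≤ 5 * M ^ 2 * t := by positivity
    linarith
  · rcases ht with rfl | ⟨rfl, hD⟩
    · have h1 : W ^ 2 + 2 * ((M + 1) * |W|) ≤ 5 * M ^ 2 := by rw [hWsq]; nlinarith
      linarith
    · -- Replacing `A` by its truncation decreases the square, since `|W + D| ≤ M + 1`.
      have hDa := abs_le.1 hD
      have hWa := abs_le.1 hW
      have htr : (A' + W + D) ^ 2 ≤ (A + W + D) ^ 2 := by
        rcases le_total A (-(M + 1)) with hA | hA
        · have : A' = -(M + 1) := by simp only [A']; rw [min_eq_right (by linarith), max_eq_left hA]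
          rw [this]; nlinarith
        · rcases le_total A (M + 1) with hA' | hA'
          · have : A' = A := by simp only [A']; rw [min_eq_right hA', max_eq_right hA]
            rw [this]
          · have : A' = M + 1 := by
              simp only [A']; rw [min_eq_left hA', max_eq_right (by linarith)]
            rw [this]; nlinarith
      have hDW : -(η * (1 + W ^ 2)) ≤ 2 * (D * W) := by
        have : |D * W| ≤ η * |W| := by rw [abs_mul]; gcongr
        have h2 := (abs_le.1 this).1
        have h3 : η * (2 * |W|) ≤ η * (1 + W ^ 2) := by
          gcongr; rw [hWsq]; nlinarith [sq_nonneg (|W| - 1)]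
        linarith
      nlinarith [sq_nonneg (A' + D)]

/-- If the residual `W` is a centred Gaussian variable that is independent of `A`, and `D` is
small with high probability, then `E (A + W + D)²` is almost at least the variance of `W`. -/
lemma ofReal_le_lintegral_sq {ν : Measure Ω} [IsProbabilityMeasure ν] {A W D : Ω → ℝ} {v : ℝ≥0}
    (hA : Measurable A) (hW : Measurable W) (hlaw : ν.map W = gaussianReal 0 v)
    (hind : IndepFun W A ν) {η M : ℝ} (hM : 1 ≤ M) (hη : η ≤ 1) (hη0 : 0 ≤ η) {S : Set Ω}
    (hS : ∀ ω ∉ S, |D ω| ≤ η) :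
    ENNReal.ofReal (v - η * (1 + v) - 5 * M ^ 2 * ν.real S -
      5 / M ^ 2 * (v ^ 2 * gaussianFourthMoment)) ≤
      ∫⁻ ω, ENNReal.ofReal ((A ω + W ω + D ω) ^ 2) ∂ν := by
  -- `S` need not be measurable.
  set T := toMeasurable ν S
  have hT : MeasurableSet T := measurableSet_toMeasurable ν S
  have hTS : ν.real T = ν.real S := by rw [measureReal_def, measure_toMeasurable]; rfl
  set A' : Ω → ℝ := fun ω => max (-(M + 1)) (min (M + 1) (A ω))
  have hA' : Measurable A' := by fun_prop
  have hind' : IndepFun A' W ν := by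
    have : Measurable fun a : ℝ => max (-(M + 1)) (min (M + 1) a) := by fun_prop
    exact (hind.comp measurable_id this).symm
  have hint : ∀ k : ℕ, Integrable (fun ω => W ω ^ k) ν := fun k => by
    have := integrable_pow_gaussianReal v k
    rw [← hlaw] at this
    exact this.comp_measurable hW
  have hI : ∀ k : ℕ, ∫ ω, W ω ^ k ∂ν = ∫ x, x ^ k ∂(gaussianReal 0 v) := fun k => by
    rw [← hlaw, integral_map hW.aemeasurable (by fun_prop)]
  have hI1 : ∫ ω, W ω ∂ν = 0 := by simpa using hI 1
  have hI2 : ∫ ω, W ω ^ 2 ∂ν = v := by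
    rw [hI 2]
    have := variance_fun_id_gaussianReal (μ := 0) (v := v)
    rwa [variance_of_integral_eq_zero (by fun_prop) (by simp)] at this
  have hI4 : ∫ ω, W ω ^ 4 ∂ν = v ^ 2 * gaussianFourthMoment := by
    rw [hI 4, integral_pow_four_gaussianReal]
  have hW1 : Integrable W ν := by simpa using hint 1
  have hA'int : Integrable A' ν := by
    refine Integrable.of_bound hA'.aestronglyMeasurable (M + 1) (Eventually.of_forall fun ω => ?_)
    exact abs_le.2 ⟨le_max_left _ _, max_le (by linarith) (min_le_left _ _)⟩
  have hAWint : Integrable (fun ω => A' ω * W ω) ν := hind'.integrable_mul hA'int hW1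
  have hAW : ∫ ω, A' ω * W ω ∂ν = 0 := by
    have := hind'.integral_mul_eq_mul_integral hA'.aestronglyMeasurable hW.aestronglyMeasurable
    rw [hI1, mul_zero] at this
    exact this
  have hTint : Integrable (T.indicator (1 : Ω → ℝ)) ν := (integrable_const (1 : ℝ)).indicator hT
  set R : Ω → ℝ := fun ω => W ω ^ 2 + 2 * (A' ω * W ω) - η * (1 + W ω ^ 2) -
    5 * M ^ 2 * T.indicator 1 ω - 5 / M ^ 2 * W ω ^ 4
  have i1 := hint 2
  have i2 := hAWint.const_mul 2
  have i3 := ((integrable_const (1 : ℝ)).add (hint 2)).const_mul η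
  have i4 := hTint.const_mul (5 * M ^ 2)
  have i5 := (hint 4).const_mul (5 / M ^ 2)
  have hR : Integrable R ν := (((i1.add i2).sub i3).sub i4).sub i5
  have hRint : ∫ ω, R ω ∂ν = v - η * (1 + v) - 5 * M ^ 2 * ν.real S -
      5 / M ^ 2 * (v ^ 2 * gaussianFourthMoment) := by
    have e5 : ∫ ω, R ω ∂ν = _ := integral_sub (((i1.add i2).sub i3).sub i4) i5
    have e4 := integral_sub ((i1.add i2).sub i3) i4
    have e3 := integral_sub (i1.add i2) i3
    have e2 := integral_add i1 i2
    have e1 := integral_add (integrable_const (μ := ν) (1 : ℝ)) (hint 2)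
    rw [integral_const_mul, hI4] at e5
    rw [integral_const_mul, integral_indicator_one hT, hTS] at e4
    rw [integral_const_mul] at e3 e2
    rw [hAW, hI2] at e2
    rw [hI2] at e1
    simp only [integral_const, probReal_univ, smul_eq_mul, mul_one] at e1
    simp only [Pi.add_apply, Pi.sub_apply] at e5 e4 e3 e2 e1
    rw [e5, e4, e3, e2, e1]
    ring
  rw [← hRint]
  refine (ofReal_integral_le_lintegral_ofReal hR).trans (lintegral_mono fun ω => ?_)
  refine ENNReal.ofReal_le_ofReal (sq_add_add_ge hM hη hη0 ?_)
  by_cases hω : ω ∈ T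
  · left; rw [Set.indicator_of_mem hω]; rfl
  · right
    exact ⟨Set.indicator_of_notMem hω _, hS ω fun h => hω (subset_toMeasurable ν S h)⟩

end

/-! ### Asymptotics of the error terms -/

section

lemma tendsto_log_mul_rpow_neg {ρ : ℝ} (hρ : 0 < ρ) :
    Tendsto (fun n : ℕ => Real.log n * (n : ℝ) ^ (-ρ)) atTop (nhds 0) := by
  have h := ((isLittleO_log_rpow_atTop hρ).tendsto_div_nhds_zero).comp tendsto_natCast_atTop_atTop
  refine h.congr fun n => ?_
  simp [Real.rpow_neg, div_eq_mul_inv]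

lemma tendsto_rpow_neg_natCast {ρ : ℝ} (hρ : 0 < ρ) :
    Tendsto (fun n : ℕ => (n : ℝ) ^ (-ρ)) atTop (nhds 0) :=
  (tendsto_rpow_neg_atTop hρ).comp tendsto_natCast_atTop_atTop

lemma tendsto_atypicalBound (c : ℝ) {γ δ : ℝ} (hγ : 0 < γ) (hδ : 0 < δ) {d : ℕ → ℕ}
    (hd : Tendsto (fun n => (d n : ℝ)) atTop atTop) (hdn : ∀ᶠ n : ℕ in atTop, (d n : ℝ) ≤ n) :
    Tendsto (fun n => atypicalBound c γ δ n (d n)) atTop (nhds 0) := by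
  have h2 := tendsto_rpow_neg_natCast (ρ := 2) (by norm_num)
  have h2' := h2.const_mul 4
  rw [mul_zero] at h2'
  have hpow : ∀ n : ℕ, 1 ≤ n → (n : ℝ) ^ 2 * (n : ℝ) ^ (-4 : ℝ) = (n : ℝ) ^ (-2 : ℝ) :=
      fun n hn => by
    have : (0 : ℝ) < n := by exact_mod_cast hn
    rw [← Real.rpow_natCast, ← Real.rpow_add this]
    norm_num
  have t1 : Tendsto (fun n : ℕ => ((n : ℝ) + 1) * (d n * (2 * (n : ℝ) ^ (-4 : ℝ)))) atTop
      (nhds 0) := by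
    refine squeeze_zero' (Eventually.of_forall fun n => by positivity) ?_
      h2'
    filter_upwards [hdn, eventually_ge_atTop 1] with n hn hn1
    have hn1' : (1 : ℝ) ≤ n := by exact_mod_cast hn1
    rw [← hpow n hn1]
    calc ((n : ℝ) + 1) * (d n * (2 * (n : ℝ) ^ (-4 : ℝ)))
        ≤ (n + n) * (n * (2 * (n : ℝ) ^ (-4 : ℝ))) := by gcongr
      _ = 4 * ((n : ℝ) ^ 2 * (n : ℝ) ^ (-4 : ℝ)) := by ring
  have t2 : Tendsto (fun n : ℕ => ((n : ℝ) + 1) * (2 * (n : ℝ) ^ (-4 : ℝ))) atTop (nhds 0) := by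
    refine squeeze_zero' (Eventually.of_forall fun n => by positivity) ?_
      h2'
    filter_upwards [eventually_ge_atTop 1] with n hn1
    have hn1' : (1 : ℝ) ≤ n := by exact_mod_cast hn1
    rw [← hpow n hn1]
    calc ((n : ℝ) + 1) * (2 * (n : ℝ) ^ (-4 : ℝ))
        ≤ (n + n) * (2 * (n : ℝ) ^ (-4 : ℝ)) := by gcongr
      _ = 4 * (n * (n : ℝ) ^ (-4 : ℝ)) := by ring
      _ ≤ 4 * ((n : ℝ) ^ 2 * (n : ℝ) ^ (-4 : ℝ)) := by gcongr; exact le_self_pow₀ hn1' two_ne_zero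
  have t3 : Tendsto (fun n : ℕ => c / (δ ^ 2 * (d n : ℝ))) atTop (nhds 0) :=
    Tendsto.const_div_atTop (hd.const_mul_atTop (by positivity)) c
  have t4 : Tendsto (fun n : ℕ => ((n : ℝ) + 1) * Real.exp (-(n : ℝ) ^ γ / 4)) atTop
      (nhds 0) := by
    have h := ((tendsto_rpow_mul_exp_neg_mul_atTop_nhds_zero (1 / γ) (1 / 4) (by norm_num)).comp
      ((tendsto_rpow_atTop hγ).comp tendsto_natCast_atTop_atTop)).const_mul 2
    rw [mul_zero] at h
    refine squeeze_zero' (Eventually.of_forall fun n => by positivity) ?_ h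
    filter_upwards [eventually_ge_atTop 1] with n hn1
    have hn1' : (1 : ℝ) ≤ n := by exact_mod_cast hn1
    simp only [Function.comp_apply]
    rw [← Real.rpow_mul (by positivity), mul_one_div_cancel hγ.ne', Real.rpow_one, ← mul_assoc]
    gcongr
    · linarith
    · apply le_of_eq; ring
  have t5 : Tendsto (fun n : ℕ => 32 * Real.log n * (n : ℝ) ^ (-δ)) atTop (nhds 0) := by
    simpa [mul_assoc] using (tendsto_log_mul_rpow_neg hδ).const_mul 32
  simpa [atypicalBound] using ((((t1.add t1).add t2).add t3).add t4).add t5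

/-- The stability estimate is of order `log n * n^(α + 4 δ - γ)`: the factor `√d` lost in the norm
of the inputs is regained in the number of labelled nodes near the threshold. -/
lemma tendsto_stabilityError {σ : ℝ} (hσ : 0 ≤ σ) {α γ δ : ℝ} (hδ : 0 < δ)
    (hαγ : α + 4 * δ < γ) {d : ℕ → ℕ} (hd : ∀ᶠ n : ℕ in atTop, 0 < d n)
    (hdn : ∀ᶠ n : ℕ in atTop, (d n : ℝ) ≤ (n : ℝ) ^ α) :
    Tendsto (fun n : ℕ => ((n : ℝ) ^ (α + 4 * δ) / √(d n : ℝ) + 1) *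
      (σ * √(8 * Real.log n) * √(d n : ℝ)) / ((n : ℝ) ^ γ / 4)) atTop (nhds 0) := by
  have hρ : 0 < γ - (α + 4 * δ) := by linarith
  have h : Tendsto (fun n : ℕ => 8 * σ * ((n : ℝ) ^ (-(γ - (α + 4 * δ))) +
      8 * (Real.log n * (n : ℝ) ^ (-(γ - (α + 4 * δ)))))) atTop (nhds 0) := by
    simpa using ((tendsto_rpow_neg_natCast hρ).add
      ((tendsto_log_mul_rpow_neg hρ).const_mul 8)).const_mul (8 * σ)
  refine squeeze_zero' (Eventually.of_forall fun n => by positivity) ?_ h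
  filter_upwards [hd, hdn, eventually_ge_atTop 1] with n hd0 hdα hn1
  have hn1' : (1 : ℝ) ≤ n := by exact_mod_cast hn1
  have hn0 : (0 : ℝ) < n := by linarith
  have hd0' : (0 : ℝ) < d n := by exact_mod_cast hd0
  have hd1 : (1 : ℝ) ≤ d n := by exact_mod_cast hd0
  have hlog : 0 ≤ Real.log n := Real.log_nonneg hn1'
  have hsd : √(d n : ℝ) ≤ (n : ℝ) ^ (α + 4 * δ) := by
    calc √(d n : ℝ) ≤ d n := Real.sqrt_le_iff.2 ⟨by positivity, by nlinarith⟩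
      _ ≤ (n : ℝ) ^ α := hdα
      _ ≤ (n : ℝ) ^ (α + 4 * δ) := Real.rpow_le_rpow_of_exponent_le hn1' (by linarith)
  have hsl : √(8 * Real.log n) ≤ 1 + 8 * Real.log n := by
    rw [Real.sqrt_le_left (by positivity)]
    nlinarith
  have hexp : (n : ℝ) ^ (-(γ - (α + 4 * δ))) = (n : ℝ) ^ (α + 4 * δ) / (n : ℝ) ^ γ := by
    rw [neg_sub, Real.rpow_sub hn0]
  rw [hexp]
  calc ((n : ℝ) ^ (α + 4 * δ) / √(d n : ℝ) + 1) *
      (σ * √(8 * Real.log n) * √(d n : ℝ)) / ((n : ℝ) ^ γ / 4)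
      = 4 * σ * √(8 * Real.log n) * ((n : ℝ) ^ (α + 4 * δ) + √(d n : ℝ)) / (n : ℝ) ^ γ := by
        have : √(d n : ℝ) ≠ 0 := (Real.sqrt_pos.2 hd0').ne'
        field_simp
    _ ≤ 4 * σ * (1 + 8 * Real.log n) * ((n : ℝ) ^ (α + 4 * δ) + (n : ℝ) ^ (α + 4 * δ)) /
        (n : ℝ) ^ γ := by gcongr
    _ = _ := by ring

/-- The uncertainty `8 σx² log n` in the inner products is negligible with respect to the threshold,
since `log n ≪ d`. -/
lemma eventually_le_mul_geoCutoff (σx : ℝ≥0) {α δ : ℝ} (hα : α < 1) (hδ : 0 < δ) {d : ℕ → ℕ}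
    (hlog : (fun n : ℕ => Real.log n) =o[atTop] fun n => (d n : ℝ)) :
    ∀ᶠ n : ℕ in atTop, (σx : ℝ) ^ 2 * (8 * Real.log n) ≤ δ * geoCutoff σx α n (d n) := by
  have h1α : 0 < 1 - α := by linarith
  filter_upwards [hlog.def (c := δ ^ 2 * (1 - α) / 32) (by positivity), eventually_ge_atTop 1]
    with n hn hn1
  have hl : 0 ≤ Real.log n := Real.log_nonneg (by exact_mod_cast hn1)
  rw [Real.norm_of_nonneg hl, Real.norm_of_nonneg (Nat.cast_nonneg _)] at hn
  unfold geoCutoff geoThreshold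
  have h : 8 * Real.log n ≤ δ * (√(2 * (1 - α) * Real.log n) * √(d n : ℝ)) := by
    rw [← Real.sqrt_mul (by positivity), ← Real.sqrt_sq hδ.le, ← Real.sqrt_mul (by positivity)]
    apply Real.le_sqrt_of_sq_le
    nlinarith
  calc (σx : ℝ) ^ 2 * (8 * Real.log n)
      ≤ (σx : ℝ) ^ 2 * (δ * (√(2 * (1 - α) * Real.log n) * √(d n : ℝ))) := by gcongr
    _ = _ := by ring

end

/-! ### The lower bound for the prediction error -/

section

/-- The direction of `β`: a unit vector, or `0` if `β = 0`. -/
def direction {d : ℕ} (β : Vec d) : Vec d := ‖β‖⁻¹ • β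

lemma norm_direction_le {d : ℕ} (β : Vec d) : ‖direction β‖ ≤ 1 := by
  rw [direction, norm_smul, norm_inv, norm_norm]
  exact inv_mul_le_one

/-- Also for `β = 0`, where `orthPart (direction β)` is the identity. -/
lemma inner_orthPart_direction {d : ℕ} (β u : Vec d) :
    inner ℝ (orthPart (direction β) u) β = 0 := by
  rcases eq_or_ne β 0 with rfl | hβ
  · simp
  · have : ‖β‖ ≠ 0 := norm_ne_zero_iff.2 hβ
    simp only [orthPart, direction, inner_sub_left, inner_smul_left, inner_smul_right,
      RCLike.conj_to_real, real_inner_self_eq_norm_sq]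
    field_simp
    ring

/-- The lower bound at a fixed sample size, in terms of the probability that a sample is not
typical and of the stability of the network on typical samples. -/
lemma ofReal_le_mse {n d : ℕ} {σx ση σε : ℝ≥0} (hσx : 0 < σx) {α γ s D τ η M : ℝ} {β : Vec d}
    (hs : 0 ≤ s) (hD : 0 < D) (hM : 1 ≤ M) (hη : η ≤ 1) (hη0 : 0 ≤ η)
    {L : ℕ} {Cψ CM C : ℝ≥0} {ψ : ℕ → Sample n d → Vec d → Vec d}
    {M₀ M₁ : ℕ → Sample n d → Matrix (Fin d) (Fin d) ℝ} {g : Sample n d → Vec d → ℝ}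
    (hN : IsTrainedNetwork β L Cψ CM ψ M₀ M₁) (hg : IsTrainedReadout β C g)
    (herr : C * (stabilityConst (Cψ * CM) L * ((τ + 1) * ((σx + ση) * s * √(d : ℝ)) / D)) ≤ η) :
    ENNReal.ofReal (residualVariance σx ση σε β - η * (1 + residualVariance σx ση σε β) -
      5 * M ^ 2 * (sampleLaw n d σx ση σε γ).real
        {ω | ¬ IsTypical σx ση α (direction β) s D τ ω} -
      5 / M ^ 2 * (residualVariance σx ση σε β ^ 2 * gaussianFourthMoment)) ≤
      mse σx ση σε γ β (prediction σx α L ψ M₀ M₁ g) := by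
  set e := direction β
  set yref := referencePrediction σx α e L ψ M₀ M₁ g
  set A : Sample n d → ℝ := fun ω =>
    slope σx ση * inner ℝ (covariate ω (Fin.last n)) β - yref ω
  have hA : Measurable[revealedSigma e] A := by
    have h1 := measurable_referencePrediction σx α e hN hg
    have h2 : Measurable[revealedSigma e] fun ω : Sample n d =>
        slope σx ση * inner ℝ (covariate ω (Fin.last n)) β :=
      measurable_of_revealed (n := n) e (f := fun p => slope σx ση * inner ℝ p.1.1 β)
        (by fun_prop)
    exact h2.sub h1
  have hind : IndepFun (residual σx ση β) A (sampleLaw n d σx ση σε γ) := by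
    have := indepFun_residual_revealed (n := n) hσx ση σε γ (inner_orthPart_direction β)
    rw [IndepFun_iff_Indep] at this ⊢
    exact indep_of_indep_of_le_right this hA.comap_le
  have hmain := ofReal_le_lintegral_sq (D := fun ω => yref ω - prediction σx α L ψ M₀ M₁ g ω)
    (hA.mono (measurable_revealed e).comap_le le_rfl)
    (measurable_residual σx ση β) (sampleLaw_map_residual hσx ση σε γ β) hind hM hη hη0
    (S := {ω | ¬ IsTypical σx ση α e s D τ ω}) (fun ω hω => by
      rw [abs_sub_comm]
      exact ((not_not.1 hω).abs_prediction_sub_le hs hD hN hg).trans herr)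
  refine hmain.trans (le_of_eq ?_)
  refine lintegral_congr fun ω => ?_
  rw [response_last_eq σx ση]
  congr 2
  simp only [A]
  ring

lemma coe_residualVariance {d : ℕ} (σx ση σε : ℝ≥0) (β : Vec d) :
    (residualVariance σx ση σε β : ℝ) = (σε : ℝ) ^ 2 +
      (σx : ℝ) ^ 2 * (ση : ℝ) ^ 2 / ((σx : ℝ) ^ 2 + (ση : ℝ) ^ 2) * ‖β‖ ^ 2 := by
  simp [residualVariance]

end

end NodeRegression

end

/-- In the regime `log n ≪ d ≪ n^α`, `α < γ`, the prediction error of every trained `L`-layer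
network without attention is at least `σε² + σx² ση² / (σx² + ση²) ‖β‖² + o(1)`. -/
theorem mainTheorem3 (σx ση σε : ℝ≥0) (hσx : 0 < σx) (α γ : ℝ) (hα : 0 < α) (hαγ : α < γ)
    (hγ : γ < 1) (d : ℕ → ℕ)
    (hlog : (fun n : ℕ => Real.log n) =o[atTop] fun n => (d n : ℝ))
    (hpow : (fun n : ℕ => (d n : ℝ)) =o[atTop] fun n => (n : ℝ) ^ α)
    (B Cψ CM C : ℝ≥0) (L : ℕ) (δ : ℝ) (hδ : 0 < δ) :
    ∀ᶠ n : ℕ in atTop,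
      ∀ (β : NodeRegression.Vec (d n)), ‖β‖ ≤ B →
      ∀ (ψ : ℕ → NodeRegression.Sample n (d n) →
          NodeRegression.Vec (d n) → NodeRegression.Vec (d n))
        (M₀ M₁ : ℕ → NodeRegression.Sample n (d n) → Matrix (Fin (d n)) (Fin (d n)) ℝ),
        NodeRegression.IsTrainedNetwork β L Cψ CM ψ M₀ M₁ →
      ∀ (g : NodeRegression.Sample n (d n) → NodeRegression.Vec (d n) → ℝ),
        NodeRegression.IsTrainedReadout β C g →
      ENNReal.ofReal ((σε : ℝ) ^ 2 +
          (σx : ℝ) ^ 2 * (ση : ℝ) ^ 2 / ((σx : ℝ) ^ 2 + (ση : ℝ) ^ 2) * ‖β‖ ^ 2) ≤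
        NodeRegression.mse σx ση σε γ β (NodeRegression.prediction σx α L ψ M₀ M₁ g) +
          ENNReal.ofReal δ := by
  open NodeRegression in
  -- The slack `ρ` in the exponents satisfies `α + 4 ρ < γ`.
  obtain ⟨ρ, hρ0, hρ1, hρ2⟩ : ∃ ρ : ℝ, 0 < ρ ∧ ρ ≤ 1 / 4 ∧ α + 4 * ρ < γ := by
    refine ⟨min (1 / 4) ((γ - α) / 8), lt_min (by norm_num) (by linarith), min_le_left _ _, ?_⟩
    have := min_le_right (1 / 4 : ℝ) ((γ - α) / 8)
    linarith
  set v : ℝ := (σε : ℝ) ^ 2 + (σx : ℝ) ^ 2 * (ση : ℝ) ^ 2 / ((σx : ℝ) ^ 2 + (ση : ℝ) ^ 2) * B ^ 2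
  have hv0 : 0 ≤ v := by positivity
  have hm0 := gaussianFourthMoment_nonneg
  -- The truncation level `M` makes the fourth moment term small.
  obtain ⟨M, hM1, hM⟩ : ∃ M : ℝ, 1 ≤ M ∧ 5 / M ^ 2 * (v ^ 2 * gaussianFourthMoment) ≤ δ / 3 := by
    have h : Tendsto (fun M : ℝ => 5 / M ^ 2 * (v ^ 2 * gaussianFourthMoment)) atTop (nhds 0) := by
      simpa using (Tendsto.const_div_atTop (tendsto_pow_atTop (two_ne_zero)) (5 : ℝ)).mul_const
        (v ^ 2 * gaussianFourthMoment)
    obtain ⟨M, h1, h2⟩ := ((eventually_ge_atTop (1 : ℝ)).and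
      (h.eventually (eventually_le_nhds (by positivity : (0 : ℝ) < δ / 3)))).exists
    exact ⟨M, h1, h2⟩
  obtain ⟨η, hη0, hη1, hη⟩ : ∃ η : ℝ, 0 < η ∧ η ≤ 1 ∧ η * (1 + v) ≤ δ / 3 := by
    refine ⟨min 1 (δ / 3 / (1 + v)), lt_min one_pos (by positivity), min_le_left _ _, ?_⟩
    rw [← le_div_iff₀ (by positivity)]
    exact min_le_right _ _
  obtain ⟨c, hc0, hc⟩ := exists_sampleLaw_real_not_isTypical_le
  have hlogtop : Tendsto (fun n : ℕ => Real.log n) atTop atTop :=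
    Real.tendsto_log_atTop.comp tendsto_natCast_atTop_atTop
  have hlogd : ∀ᶠ n : ℕ in atTop, 64 * Real.log n ≤ d n := by
    filter_upwards [hlog.def (c := 1 / 64) (by norm_num), eventually_ge_atTop 1] with n hn hn1
    rw [Real.norm_of_nonneg (Real.log_nonneg (by exact_mod_cast hn1)),
      Real.norm_of_nonneg (Nat.cast_nonneg _)] at hn
    linarith
  have hdtop : Tendsto (fun n => (d n : ℝ)) atTop atTop :=
    tendsto_atTop_mono' _ hlogd (hlogtop.const_mul_atTop (by norm_num))
  have hdpos : ∀ᶠ n : ℕ in atTop, 0 < d n := by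
    filter_upwards [hdtop.eventually_gt_atTop 0] with n hn
    exact_mod_cast hn
  have hdα : ∀ᶠ n : ℕ in atTop, (d n : ℝ) ≤ (n : ℝ) ^ α := by
    filter_upwards [hpow.def (c := 1) one_pos] with n hn
    rwa [Real.norm_of_nonneg (Nat.cast_nonneg _), Real.norm_of_nonneg (by positivity),
      one_mul] at hn
  have hdn : ∀ᶠ n : ℕ in atTop, (d n : ℝ) ≤ n := by
    filter_upwards [hdα, eventually_ge_atTop 1] with n hn hn1
    exact hn.trans (Real.rpow_le_self_of_one_le (by exact_mod_cast hn1) (by linarith))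
  have hbad : ∀ᶠ n : ℕ in atTop, 5 * M ^ 2 * atypicalBound c γ ρ n (d n) ≤ δ / 3 := by
    have h := (tendsto_atypicalBound c (hα.trans hαγ) hρ0 hdtop hdn).const_mul (5 * M ^ 2)
    rw [mul_zero] at h
    exact h.eventually (eventually_le_nhds (by positivity))
  have herr : ∀ᶠ n : ℕ in atTop, C * (stabilityConst (Cψ * CM) L *
      (((n : ℝ) ^ (α + 4 * ρ) / √(d n : ℝ) + 1) *
        ((σx + ση) * √(8 * Real.log n) * √(d n : ℝ)) / ((n : ℝ) ^ γ / 4))) ≤ η := by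
    have h := ((tendsto_stabilityError (σ := σx + ση) (by positivity) hρ0 hρ2 hdpos
      hdα).const_mul (stabilityConst (Cψ * CM) L)).const_mul (C : ℝ)
    rw [mul_zero, mul_zero] at h
    exact h.eventually (eventually_le_nhds hη0)
  filter_upwards [hbad, herr, hlogd, hdpos, eventually_ge_atTop 1,
    eventually_le_mul_geoCutoff σx (hαγ.trans hγ) hρ0 hlog] with n hbad herr hlogd hdpos hn1 hcut
  intro β hβ ψ M₀ M₁ hN g hg
  have hn0 : (0 : ℝ) < n := by exact_mod_cast hn1
  have hprob := hc n (d n) σx ση σε α γ ρ (direction β) hσx hn1 hdpos hα (hαγ.trans hγ) hγ.le hρ0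
    hρ1 (norm_direction_le β) hcut hlogd
  have hmse := ofReal_le_mse (σε := σε) (α := α) (γ := γ) hσx (Real.sqrt_nonneg _)
    (by positivity) hM1 hη1 hη0.le hN hg herr
  rw [← coe_residualVariance]
  set w : ℝ := ((residualVariance σx ση σε β : ℝ≥0) : ℝ)
  have hw0 : 0 ≤ w := NNReal.coe_nonneg _
  have hwv : w ≤ v := by
    simp only [w, v, coe_residualVariance]
    gcongr
  have h1 : η * (1 + w) ≤ δ / 3 := le_trans (by gcongr) hη
  have h2 : 5 / M ^ 2 * (w ^ 2 * gaussianFourthMoment) ≤ δ / 3 := le_trans (by gcongr) hM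
  have h3 := (mul_le_mul_of_nonneg_left hprob (by positivity : 0 ≤ 5 * M ^ 2)).trans hbad
  calc ENNReal.ofReal w ≤ ENNReal.ofReal (w - δ) + ENNReal.ofReal δ := by
        simpa only [sub_add_cancel] using ENNReal.ofReal_add_le (p := w - δ) (q := δ)
    _ ≤ _ := by
        gcongr
        refine le_trans (ENNReal.ofReal_le_ofReal ?_) hmse
        linarith
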